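/- Let $G=(V,E)$ be a finite loopless (multi)graph with $V\neq\emptyset$, let $c:E\to\mathbb R_{\ge 0}$, and for every $v\in V$ let $M_v$ be a matroid whose ground set is the set $\delta_G(v)$ of edges incident to $v$. For a graph $H=(W,F)$ and $x\in\mathbb R^F$ write $x(S)=\sum_{f\in S}x(f)$, let $F[L]$ be the set of edges with both endpoints in $L\subseteq W$, and let $\delta(w)$ be the set of edges incident to $w$. The spanning tree polytope $P_{st}$ of $H$ is the set of $x\ge 0$ with $x(F)=|W|-1$ and $x(F[L])\le |L|-1$ for all $\emptyset\ne L\subseteq W$; the inequality for $L$ is *tight* if $x(F[L])=|L|-1$. For a matroid $N$ with rank function $r$ on a ground set $S$, $P_N=\{y\in\mathbb R^S_{\ge0}: y(A)\le r(A)\ \forall A\subseteq S\}$. An element $f$ is *free* in $N$ if $I\cup\{f\}$ is independent for every independent $I$. *The algorithm.* It maintains a graph $H=(W,F)$ obtained from $G$ by deleting and contracting edges, so that its nodes $w\in W$ are sets of vertices of $G$; a matroid $N_v$ for every $v\in V$, on the set of edges of $F$ that are incident to $v$ in $G$; and a list of fixed linear equations. For a node $w$, $N_w$ denotes the disjoint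 union of the matroids $N_v$, $v\in w$. An edge $f\in\delta(w)$ is *contained* in the degree constraint $N_w$ if it is not free in $N_w$. Initially $H=G$, $N_v=M_v$, and no equation is fixed. While $|W|>1$, the following steps are performed. (a) Determine a basic optimal solution (an optimal vertex) $x$ of the linear program $\min c^Tx$ subject to $x\in P_{st}$ (of $H$), $x|_{\delta(w)}\in P_{N_w}$ for all $w\in W$, and all fixed equations. Delete all edges with $x(f)=0$, from $H$ and from the matroids. (b) Contract all edges with $x(f)=1$, in $H$ and in the matroids. (c) Choose a maximal family of tight spanning tree constraints of $H$ with respect to $x$ that are linearly independent, and fix the equations $x(F[L])=|L|-1$ for its members $L$. In later iterations, deleted edges count with value $0$ and contracted edges with value $1$ in these equations. Moreover let $Q\subseteq W$ be the result of starting with $Q=\emptyset$ and, as long as there is a node $w\in W\setminus Q$ with $x(\delta(w)\cap F[W\setminus Q])=1$, adding such a node to $Q$ (any choices may be made). (d) Type A adaptations: for each node $w\in W$ (one after the other, in any order), let $U\subseteq\delta(w)$ be the set of edges that are currently contained in the degree constraints at both of their end nodes. If $U\neq\emptyset$ and $|U|-x(U)\le4$, remove $U$ from $N_w$. (e) Type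 B adaptations: for each node $w\in W$ (one after the other, in any order), let $U\subseteq\delta(w)$ be the set of edges that are currently contained in $N_w$ and are not incident to a node of $Q$. If $U\neq\emptyset$ and $|U|-x(U)\le4$, remove $U$ from $N_w$. When $|W|\le 1$, the algorithm stops and returns the set $T$ of all contracted edges. *Removing $U$ from $N_w$* means the following. For every $v\in w$, let $S_v$ be the ground set of $N_v$, let $M_1$ be the matroid on $S_v$ whose independent sets are the sets $I\subseteq S_v\cap U$ with $|I|\le|S_v\cap U|-\lfloor x(S_v\cap U)\rfloor$, and let $M_2=M_1\vee N_v$ be the matroid union. Replace $N_v$ by the disjoint union $N'_v$ of $M_2/(S_v\cap U)$ and the free matroid on $S_v\cap U$. The matroids $N_v$ with $v\notin w$ are kept. Instead, one may also, in each removal, use any other matroids $N'_v$ $(v\in V)$ such that, with $N'_w$ the disjoint union of the $N'_v$, $v\in w$: (i) $N'_v$ has ground set $S_v$ for $v\in w$; (ii) $I\cup U$ is independent in $N'_w$ whenever $I$ is; (iii) for $v\in w$, every independent set of $N'_v$ becomes independent in $N_v$ after removing at most $\lceil|U|-x(U)\rceil$ suitable edges; (iv) $x|_{\delta(w)}\in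 P_{N'_w}$; (v) $N'_v=N_v$ if $v\notin w$ or $S_v\cap U=\emptyset$; (vi) for $v\in w$, every element that is free in $N_v$ is free in $N'_v$. **Claim.** If the algorithm terminates, then the returned set $T$ is a spanning tree of $G$, and $T$ violates each degree constraint by at most $8$ units: for every $v\in V$ there is a set $R\subseteq\delta_G(v)\cap T$ with $|R|\le 8$ such that $(T\setminus R)\cap\delta_G(v)$ is independent in $M_v$. -/

import Mathlib

open Set
open scoped Graph

/-!
Multigraphs are Mathlib's `Graph α E` (vertices in `α`, edges in `E`). A vector indexed by the edges
of a graph is a function `x : E → ℝ`; entries outside of the edge set in question are ignored or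
required to vanish. A node of the current graph is a set of vertices of the original graph.
-/

namespace MatroidalMST

noncomputable section

variable {V α E : Type*}

/-! ### Vectors, polytopes, spanning trees -/

/-- `x(S) = ∑_{e ∈ S} x(e)`. -/
def wt [Fintype E] (x : E → ℝ) (S : Set E) : ℝ := ∑ e, S.indicator x e

/-- `F[L]`: the edges of `H` with both endpoints in `L`. -/
def edgesWithin (H : Graph α E) (L : Set α) : Set E := E(H.induce L)

/-- The spanning tree polytope of `H`, as a set of vectors supported on the edges of `H`. -/
def spanningTreePolytope [Fintype E] (H : Graph α E) : Set (E → ℝ) :=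
  {x | (∀ e, 0 ≤ x e) ∧ (∀ e, e ∉ E(H) → x e = 0) ∧
    wt x E(H) = (V(H).ncard : ℝ) - 1 ∧
    ∀ L ⊆ V(H), L.Nonempty → wt x (edgesWithin H L) ≤ (L.ncard : ℝ) - 1}

/-- The vectors whose restriction to the ground set of `M` lies in the matroid polytope `P_M`. -/
def matroidPolytope [Fintype E] (M : Matroid E) : Set (E → ℝ) :=
  {x | (∀ e ∈ M.E, 0 ≤ x e) ∧ ∀ S ⊆ M.E, wt x S ≤ ((M.eRk S).toNat : ℝ)}

/-- `T` is (the edge set of) a spanning tree of `G`: it connects all vertices and has exactly one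
edge less than there are vertices. -/
def IsSpanningTree (G : Graph α E) (T : Set E) : Prop :=
  T ⊆ E(G) ∧ T.ncard + 1 = V(G).ncard ∧
    ∀ u ∈ V(G), ∀ v ∈ V(G), Relation.ReflTransGen (fun a b => ∃ f ∈ T, G.IsLink f a b) u v

/-- The edge set `T` violates the matroidal constraint `M` (on the edge set `δ`) by at most `k`
units. -/
def ViolatesByAtMost (M : Matroid E) (δ T : Set E) (k : ℕ) : Prop :=
  ∃ R ⊆ δ ∩ T, R.ncard ≤ k ∧ M.Indep ((T \ R) ∩ δ)

/-! ### Degree constraints of nodes -/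

open scoped Function in
open scoped Classical in
/-- The degree constraint `N_w` at the node `w`: the disjoint union (direct sum) of the matroids
`N v`, where `v` ranges over the vertices contained in `w`. (In every state that the algorithm
reaches, the ground sets of these matroids are pairwise disjoint; otherwise the value is junk.) -/
def nodeConstraint (N : V → Matroid E) (w : Set V) : Matroid E :=
  if h : Pairwise (Disjoint on fun v : w => (N v).E) then
    Matroid.disjointSigma (fun v : w => N v) h
  else Matroid.emptyOn E

/-- `f` is a free element of `M`. -/
def IsFreeElement (M : Matroid E) (f : E) : Prop :=
  f ∈ M.E ∧ ∀ I, M.Indep I → M.Indep (insert f I)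

/-- The edges of `δ(w)` that are contained in the degree constraint at the node `w`. -/
def containedEdges (H : Graph (Set V) E) (N : V → Matroid E) (w : Set V) : Set E :=
  {f | f ∈ H.incidenceSet w ∧ ¬ IsFreeElement (nodeConstraint N w) f}

/-! ### Contraction of edges in the graph -/

/-- The node into which `w` is merged when the edges in `D` are contracted: the union of all nodes
connected to `w` by edges in `D`. -/
def mergedNode (H : Graph (Set V) E) (D : Set E) (w : Set V) : Set V :=
  ⋃₀ {w' | w' ∈ V(H) ∧ Relation.EqvGen (fun a b => ∃ f ∈ D, H.IsLink f a b) w w'}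

/-- The graph `H / D`. -/
def contractEdges (H : Graph (Set V) E) (D : Set E) : Graph (Set V) E :=
  (H.deleteEdges D).map (mergedNode H D)

/-! ### Removal of a set of edges from a degree constraint -/

/-- `M` is the matroid union `M₁ ∨ M₂`. -/
def IsMatroidUnion (M₁ M₂ M : Matroid E) : Prop :=
  M.E = M₁.E ∪ M₂.E ∧
    ∀ J, M.Indep J ↔ ∃ I₁ I₂, M₁.Indep I₁ ∧ M₂.Indep I₂ ∧ J = I₁ ∪ I₂

/-- The explicit procedure applied to the constraint `N` of a single vertex, with ground set
`S = N.E`: `M₁` is the matroid on `S` whose independent sets are the subsets of `S ∩ U` of size at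
most `|S ∩ U| - ⌊x(S ∩ U)⌋`, `M₂ = M₁ ∨ N`, and the new constraint is the disjoint union of
`M₂ / (S ∩ U)` and the free matroid on `S ∩ U`. -/
def IsVertexRemoval [Fintype E] (x : E → ℝ) (U : Set E) (N N' : Matroid E) : Prop :=
  ∃ M₁ M₂ : Matroid E,
    M₁.E = N.E ∧
    (∀ I, M₁.Indep I ↔ I ⊆ N.E ∩ U ∧
      (I.ncard : ℤ) ≤ ((N.E ∩ U).ncard : ℤ) - ⌊wt x (N.E ∩ U)⌋) ∧
    IsMatroidUnion M₁ N M₂ ∧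
    N' = (M₂.contract (N.E ∩ U)).disjointSum (Matroid.freeOn (N.E ∩ U))
      (by
        rw [Matroid.contract_ground, Matroid.freeOn_ground]
        exact Set.disjoint_sdiff_left)

/-- The explicit procedure for removing `U` from the degree constraint at the node `w`: it is
applied to the constraint of every vertex contained in `w`. -/
def IsExplicitRemoval [Fintype E] (x : E → ℝ) (w : Set V) (U : Set E)
    (N N' : V → Matroid E) : Prop :=
  (∀ v ∈ w, IsVertexRemoval x U (N v) (N' v)) ∧ ∀ v, v ∉ w → N' v = N v

/-- A general operation that removes `U` from the degree constraint at the node `w`. -/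
structure IsAdmissibleRemoval [Fintype E] (x : E → ℝ) (w : Set V) (U : Set E)
    (N N' : V → Matroid E) : Prop where
  /-- the new constraint is a disjoint union of constraints of the vertices contained in `w` -/
  ground : ∀ v ∈ w, (N' v).E = (N v).E
  /-- the edges of `U` are free in the new constraint at `w` -/
  free : ∀ I, (nodeConstraint N' w).Indep I → (nodeConstraint N' w).Indep (I ∪ U)
  /-- few edges have to be removed from a set that is independent in the new constraint -/
  transform : ∀ v ∈ w, ∀ I, (N' v).Indep I →
    ∃ R ⊆ I, (R.ncard : ℤ) ≤ ⌈(U.ncard : ℝ) - wt x U⌉ ∧ (N v).Indep (I \ R)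
  /-- `x` remains feasible -/
  feasible : x ∈ matroidPolytope (nodeConstraint N' w)
  /-- constraints of vertices not contained in `w`, or not incident to an edge of `U`, are kept -/
  unchanged : ∀ v, (v ∉ w ∨ Disjoint (N v).E U) → N' v = N v
  /-- edges that are not contained in the constraint do not become contained again -/
  stays_free : ∀ v ∈ w, ∀ f, IsFreeElement (N v) f → IsFreeElement (N' v) f

/-- `N'` results from `N` by removing `U` from the degree constraint at `w`, either by the explicit
procedure or by some admissible removal operation. -/
def Removes [Fintype E] (x : E → ℝ) (w : Set V) (U : Set E) (N N' : V → Matroid E) : Prop :=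
  IsExplicitRemoval x w U N N' ∨ IsAdmissibleRemoval x w U N N'

/-! ### The states of the algorithm and its linear program -/

/-- A state of the algorithm. -/
structure State (V E : Type*) where
  /-- the current graph `H = (W, F)`; its nodes are sets of vertices of the original graph -/
  H : Graph (Set V) E
  /-- the remaining degree bound at each vertex of the original graph -/
  N : V → Matroid E
  /-- the edges that have been contracted so far -/
  contracted : Set E
  /-- the fixed constraints `x(A) = k`; contracted edges of `A` count with value `1` and deleted
  ones with value `0` -/
  fixed : Set (Set E × ℤ)

/-- The initial state: `H = G` (each vertex `v` being the node `{v}`) and `N = M`. -/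
def initialState (G : Graph V E) (M : V → Matroid E) : State V E where
  H := G.map (fun v => {v})
  N := M
  contracted := ∅
  fixed := ∅

/-- The feasible region of the linear program, including the constraints fixed so far. -/
def lpFeasible [Fintype E] (s : State V E) : Set (E → ℝ) :=
  {x | x ∈ spanningTreePolytope s.H ∧
    (∀ w ∈ V(s.H), x ∈ matroidPolytope (nodeConstraint s.N w)) ∧
    ∀ p ∈ s.fixed, wt x p.1 + ((p.1 ∩ s.contracted).ncard : ℝ) = p.2}

/-- `x` is a basic optimal solution of the linear program: an optimal solution that is a vertex of
the feasible region. -/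
def IsBasicOptimal [Fintype E] (c : E → ℝ) (s : State V E) (x : E → ℝ) : Prop :=
  x ∈ (lpFeasible s).extremePoints ℝ ∧
    ∀ y ∈ lpFeasible s, ∑ e, c e * x e ≤ ∑ e, c e * y e

/-! ### The steps of one iteration -/

/-- Delete all edges of the current graph with `x(f) = 0`. -/
def deleteZeros (s : State V E) (x : E → ℝ) : State V E where
  H := s.H.deleteEdges {f | f ∈ E(s.H) ∧ x f = 0}
  N := fun v => (s.N v).delete {f | f ∈ E(s.H) ∧ x f = 0}
  contracted := s.contracted
  fixed := s.fixed

/-- Contract all edges of the current graph with `x(f) = 1`. -/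
def contractOnes (s : State V E) (x : E → ℝ) : State V E where
  H := contractEdges s.H {f | f ∈ E(s.H) ∧ x f = 1}
  N := fun v => (s.N v).contract {f | f ∈ E(s.H) ∧ x f = 1}
  contracted := s.contracted ∪ {f | f ∈ E(s.H) ∧ x f = 1}
  fixed := s.fixed

/-- `L` is a tight spanning tree constraint of `H` with respect to `x`. -/
def IsTight [Fintype E] (H : Graph α E) (x : E → ℝ) (L : Set α) : Prop :=
  L ⊆ V(H) ∧ L.Nonempty ∧ wt x (edgesWithin H L) = (L.ncard : ℝ) - 1

/-- `𝓛` is a maximal family of linearly independent tight spanning tree constraints. -/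
def IsMaximalTightFamily [Fintype E] (H : Graph α E) (x : E → ℝ) (𝓛 : Set (Set α)) : Prop :=
  Maximal (fun 𝓓 : Set (Set α) => (∀ L ∈ 𝓓, IsTight H x L) ∧
    LinearIndepOn ℝ (fun L => (edgesWithin H L).indicator (1 : E → ℝ)) 𝓓) 𝓛

/-- Fix the spanning tree constraints in `𝓛`. -/
def fixFamily (s : State V E) (𝓛 : Set (Set (Set V))) : State V E where
  H := s.H
  N := s.N
  contracted := s.contracted
  fixed := s.fixed ∪ (fun L => (edgesWithin s.H L, (L.ncard : ℤ) - 1)) '' 𝓛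

/-- `x(δ(w) ∩ F[W \ Q]) = 1`: the node `w` can be added to `Q`. -/
def CanBeAdded [Fintype E] (H : Graph α E) (x : E → ℝ) (Q : Set α) (w : α) : Prop :=
  w ∈ V(H) ∧ w ∉ Q ∧ wt x (H.incidenceSet w ∩ edgesWithin H (V(H) \ Q)) = 1

/-- The sets that occur in the iterative construction of `Q(H, x)`. -/
inductive QReachable [Fintype E] (H : Graph α E) (x : E → ℝ) : Set α → Prop
  | empty : QReachable H x ∅
  | add (Q : Set α) (w : α) :
      QReachable H x Q → CanBeAdded H x Q w → QReachable H x (insert w Q)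

/-- `Q` is a final result of the iterative construction of `Q(H, x)`. -/
def IsQ [Fintype E] (H : Graph α E) (x : E → ℝ) (Q : Set α) : Prop :=
  QReachable H x Q ∧ ∀ w, ¬ CanBeAdded H x Q w

/-- The edges of `δ(w)` that are still contained in both degree constraints (those at their two
end nodes). -/
def typeASet (H : Graph (Set V) E) (N : V → Matroid E) (w : Set V) : Set E :=
  {f | f ∈ H.incidenceSet w ∧ ∀ u, H.Inc f u → f ∈ containedEdges H N u}

/-- The edges of `δ(w)` that are contained in the degree constraint at `w` but are not adjacent to a
node in `Q`. -/
def typeBSet (H : Graph (Set V) E) (Q : Set (Set V)) (N : V → Matroid E) (w : Set V) : Set E :=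
  {f | f ∈ containedEdges H N w ∧ ∀ q ∈ Q, ¬ H.Inc f q}

/-- A degree adaptation can be performed with the edge set `U`. -/
def IsEligible [Fintype E] (x : E → ℝ) (U : Set E) : Prop :=
  U.Nonempty ∧ (U.ncard : ℝ) - wt x U ≤ 4

/-- `AdaptLoop x U ws N N'`: going through the nodes in the list `ws` one after the other and
removing the edge set `U N w` (determined by the constraints `N` at that time) from the constraint
at `w` whenever it is eligible turns the constraints `N` into `N'`. -/
inductive AdaptLoop [Fintype E] (x : E → ℝ) (U : (V → Matroid E) → Set V → Set E) :
    List (Set V) → (V → Matroid E) → (V → Matroid E) → Prop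
  | done (N : V → Matroid E) : AdaptLoop x U [] N N
  | skip (w : Set V) (ws : List (Set V)) (N N' : V → Matroid E) :
      ¬ IsEligible x (U N w) → AdaptLoop x U ws N N' → AdaptLoop x U (w :: ws) N N'
  | adapt (w : Set V) (ws : List (Set V)) (N N₁ N' : V → Matroid E) :
      IsEligible x (U N w) → Removes x w (U N w) N N₁ → AdaptLoop x U ws N₁ N' →
      AdaptLoop x U (w :: ws) N N'

/-- The loop over all nodes of `H`, each taken once, in an arbitrary order. -/
def AdaptAll [Fintype E] (H : Graph (Set V) E) (x : E → ℝ)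
    (U : (V → Matroid E) → Set V → Set E) (N N' : V → Matroid E) : Prop :=
  ∃ ws : List (Set V), ws.Nodup ∧ (∀ w, w ∈ ws ↔ w ∈ V(H)) ∧ AdaptLoop x U ws N N'

/-- One iteration of the while loop leads from the state `s` to the state `t`. -/
def Iteration [Fintype E] (c : E → ℝ) (s t : State V E) : Prop :=
  1 < V(s.H).ncard ∧
  ∃ (x : E → ℝ) (s₁ : State V E) (𝓛 : Set (Set (Set V))) (Q : Set (Set V))
      (NA NB : V → Matroid E),
    IsBasicOptimal c s x ∧
    s₁ = contractOnes (deleteZeros s x) x ∧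
    IsMaximalTightFamily s₁.H x 𝓛 ∧
    IsQ s₁.H x Q ∧
    AdaptAll s₁.H x (typeASet s₁.H) s₁.N NA ∧
    AdaptAll s₁.H x (typeBSet s₁.H Q) NA NB ∧
    t = { fixFamily s₁ 𝓛 with N := NB }

/-- The algorithm, run on the graph `G` with degree constraints `M` and costs `c`, can terminate and
return the edge set `T`. -/
def TerminatesWith [Fintype E] (G : Graph V E) (M : V → Matroid E) (c : E → ℝ) (T : Set E) :
    Prop :=
  ∃ s : State V E, Relation.ReflTransGen (Iteration c) (initialState G M) s ∧
    ¬ 1 < V(s.H).ncard ∧ T = s.contracted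

end

end MatroidalMST

/-! Every vertex pays for at most one type A and one type B removal, and each payment is at most 4
edges. Removing `U` makes its edges free, and `|U| - x(U) ≤ 4` ensures that an independent set of
the new matroid becomes independent in the old one after dropping at most 4 edges. For the explicit
procedure this is `IsVertexRemoval.transform`; that it keeps `x` in the polytope
(`IsVertexRemoval.mem_matroidPolytope`) is a rank estimate for the matroid union.

Freeness survives deletion, contraction and removal. Once a type A removal has touched an edge at
`v`, every edge at `v` still contained there is free at its other end, forever, so no later type A
set meets `δ(v)` (`ConstraintInvariant.typeA`). Once a type B removal has touched an edge at `v`,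
every edge at `v` still contained there is incident to `Q`, so no further type B set meets `δ(v)`
while `Q` is current (`ConstraintInvariant.typeB`).

The difficulty is that `Q` is recomputed in each iteration: no edge covered by the old `Q` may
become uncovered unless it is deleted or contracted. The steps of the construction of `Q` are
differences of weights of tight sets. The fixed equations determine these weights
(`IsMaximalTightFamily.wt_eq`), so the old `Q` can be rebuilt for every later feasible solution
(`QReachable.of_eq_on_tight`). After contraction, some reachable set covers all surviving edges that
were covered (`QReachable.contract`), and a final result covers whatever any reachable set covers
(`IsQ.exists_inc`).

The tree property is a count: by the tree constraints, contracting value-1 edges merges nodes along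
forests, so the number of contracted edges plus the number of nodes is constant. -/

namespace MatroidalMST

/-! ### Weights of edge sets and induced edge sets -/

section Weights

variable {E : Type*} [Fintype E] {x y : E → ℝ} {S T : Set E}

lemma wt_union (h : Disjoint S T) : wt x (S ∪ T) = wt x S + wt x T := by
  simp only [wt, ← Finset.sum_add_distrib, Set.indicator_union_of_disjoint h]

lemma wt_empty : wt x ∅ = 0 := by simp [wt]

lemma wt_singleton (e : E) : wt x {e} = x e := by
  classical
  simp [wt, Set.indicator_apply]

lemma wt_congr (h : ∀ e ∈ S, x e = y e) : wt x S = wt y S := by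
  simp only [wt]
  congr 1 with e
  by_cases he : e ∈ S <;> simp [he, h]

lemma wt_diff (h : T ⊆ S) : wt x (S \ T) = wt x S - wt x T := by
  conv_rhs => rw [← Set.sdiff_union_of_subset h, wt_union Set.disjoint_sdiff_left]
  ring

lemma wt_nonneg (h : ∀ e ∈ S, 0 ≤ x e) : 0 ≤ wt x S :=
  Finset.sum_nonneg fun e _ => Set.indicator_apply_nonneg (h e)

lemma wt_mono (hST : S ⊆ T) (h : ∀ e ∈ T, 0 ≤ x e) : wt x S ≤ wt x T := by
  have := wt_diff (x := x) hST
  have h2 : 0 ≤ wt x (T \ S) := wt_nonneg fun e he => h e he.1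
  linarith

lemma wt_eq_ncard (h : ∀ e ∈ S, x e = 1) : wt x S = S.ncard := by
  classical
  rw [wt_congr (y := 1) (by simpa using h), Set.ncard_eq_toFinset_card']
  simp [wt, Set.indicator_apply, Finset.sum_boole]

lemma wt_le_ncard (h : ∀ e ∈ S, x e ≤ 1) : wt x S ≤ S.ncard := by
  rw [← wt_eq_ncard (x := 1) (S := S) (by simp)]
  refine Finset.sum_le_sum fun e _ => ?_
  by_cases he : e ∈ S <;> simp [he, h]

lemma wt_eq_zero (h : ∀ e ∈ S, x e = 0) : wt x S = 0 := by
  rw [wt_congr (y := 0) (by simpa using h)]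
  simp [wt]

lemma wt_eq_sum_mul : wt x S = ∑ e, S.indicator (1 : E → ℝ) e * x e := by
  simp only [wt]
  congr 1 with e
  by_cases he : e ∈ S <;> simp [he]

end Weights

section EdgesWithin

variable {α E : Type*} {H : Graph α E} {L : Set α} {f : E} {a b : α}

lemma mem_edgesWithin : f ∈ edgesWithin H L ↔ ∃ a b, H.IsLink f a b ∧ a ∈ L ∧ b ∈ L := by
  simp [edgesWithin, Graph.edgeSet_induce]

lemma mem_edgesWithin_iff (h : H.IsLink f a b) : f ∈ edgesWithin H L ↔ a ∈ L ∧ b ∈ L := by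
  rw [mem_edgesWithin]
  refine ⟨?_, fun h' => ⟨a, b, h, h'⟩⟩
  rintro ⟨c, d, hl, hc, hd⟩
  obtain ⟨rfl, rfl⟩ | ⟨rfl, rfl⟩ := h.eq_and_eq_or_eq_and_eq hl <;> tauto

lemma edgesWithin_subset : edgesWithin H L ⊆ E(H) := fun _ h => by
  obtain ⟨a, b, hl, -⟩ := mem_edgesWithin.1 h
  exact hl.edge_mem

lemma delete_edgesWithin (Z : Set E) (L : Set α) :
    edgesWithin (H.deleteEdges Z) L = edgesWithin H L \ Z := by
  ext f
  simp only [mem_edgesWithin, mem_sdiff, Graph.deleteEdges_isLink]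
  grind

lemma edgesWithin_vertexSet : edgesWithin H V(H) = E(H) := by
  simp [edgesWithin]

lemma edgesWithin_mono {L' : Set α} (h : L ⊆ L') : edgesWithin H L ⊆ edgesWithin H L' := fun f hf => by
  obtain ⟨a, b, hl, ha, hb⟩ := mem_edgesWithin.1 hf
  exact mem_edgesWithin.2 ⟨a, b, hl, h ha, h hb⟩

lemma edgesWithin_diff_singleton (w : α) :
    edgesWithin H L = edgesWithin H (L \ {w}) ∪ (H.incidenceSet w ∩ edgesWithin H L) := by
  ext f
  by_cases hf : f ∈ E(H)
  · obtain ⟨a, b, hl⟩ := Graph.exists_isLink_of_mem_edgeSet hf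
    have hw : H.Inc f w ↔ w = a ∨ w = b :=
      ⟨fun h => h.eq_or_eq_of_isLink hl, by
        rintro (rfl | rfl)
        exacts [hl.inc_left, hl.inc_right]⟩
    simp only [mem_union, mem_inter_iff, mem_edgesWithin_iff hl, Graph.mem_incidenceSet, mem_sdiff,
      mem_singleton_iff, hw]
    grind
  · exact iff_of_false (fun h => hf (edgesWithin_subset h)) (by
      rintro (h | h)
      exacts [hf (edgesWithin_subset h), hf (edgesWithin_subset h.2)])

lemma disjoint_edgesWithin_diff_singleton (w : α) :
    Disjoint (edgesWithin H (L \ {w})) (H.incidenceSet w ∩ edgesWithin H L) := by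
  rw [Set.disjoint_left]
  rintro f hf ⟨hw, -⟩
  obtain ⟨a, b, hl, ha, hb⟩ := mem_edgesWithin.1 hf
  rcases Graph.Inc.eq_or_eq_of_isLink hw hl with rfl | rfl
  exacts [ha.2 rfl, hb.2 rfl]

/-- This turns the test for adding `w` to `Q` into a difference of two tree-constraint weights. -/
lemma wt_edgesWithin_diff_singleton [Fintype E] (x : E → ℝ) (w : α) : wt x (H.incidenceSet w ∩ edgesWithin H L) =
      wt x (edgesWithin H L) - wt x (edgesWithin H (L \ {w})) := by
  conv_rhs => rw [edgesWithin_diff_singleton w,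
    wt_union (disjoint_edgesWithin_diff_singleton w)]
  ring

end EdgesWithin

/-! ### Consequences of the spanning tree constraints -/

section TreeConstraints

variable {α β E : Type*} [Fintype E] {H : Graph α E} {x : E → ℝ}

/-- `x` satisfies the spanning tree constraints of `H`; its entries outside of `E(H)` are
arbitrary. -/
structure SatisfiesTreeConstraints (H : Graph α E) (x : E → ℝ) : Prop where
  nonneg : ∀ e ∈ E(H), 0 ≤ x e
  total : wt x E(H) = (V(H).ncard : ℝ) - 1
  le : ∀ L ⊆ V(H), L.Nonempty → wt x (edgesWithin H L) ≤ (L.ncard : ℝ) - 1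

lemma SatisfiesTreeConstraints.of_mem (hx : x ∈ spanningTreePolytope H) :
    SatisfiesTreeConstraints H x :=
  ⟨fun e _ => hx.1 e, hx.2.2.1, hx.2.2.2⟩

/-- The constraint of a single vertex bounds the weight of its loops by 0. -/
lemma SatisfiesTreeConstraints.not_isLink_self (hx : SatisfiesTreeConstraints H x)
    (hpos : ∀ e ∈ E(H), 0 < x e) (f : E) (a : α) : ¬ H.IsLink f a a := fun h => by
  have h1 := hx.le {a} (by simpa using h.left_mem) (by simp)
  have h2 : wt x {f} ≤ wt x (edgesWithin H {a}) :=
    wt_mono (by simpa using (mem_edgesWithin_iff h).2 (by simp))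
      fun e he => hx.nonneg e (edgesWithin_subset he)
  rw [wt_singleton] at h2
  have := hpos f h.edge_mem
  simp at h1
  linarith

lemma SatisfiesTreeConstraints.le_one (hx : SatisfiesTreeConstraints H x) {f : E}
    (hf : f ∈ E(H)) : x f ≤ 1 := by
  obtain ⟨a, b, h⟩ := Graph.exists_isLink_of_mem_edgeSet hf
  have h1 := hx.le {a, b} (by
    rintro c (rfl | rfl)
    exacts [h.left_mem, h.right_mem]) (by simp)
  have h2 : wt x {f} ≤ wt x (edgesWithin H {a, b}) :=
    wt_mono (by simpa using (mem_edgesWithin_iff h).2 (by simp))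
      fun e he => hx.nonneg e (edgesWithin_subset he)
  rw [wt_singleton] at h2
  have : (({a, b} : Set α).ncard : ℝ) ≤ 2 := by 
    exact_mod_cast (Set.ncard_insert_le a {b}).trans (by simp)
  linarith

end TreeConstraints

/-! ### Contraction of edges of value 1, and deletion of edges of value 0 -/

section LinkedBy

variable {α E : Type*} {H : Graph α E}

/-- The relation of being linked by an edge of `D`. -/
def LinkedBy (H : Graph α E) (D : Set E) (a b : α) : Prop := ∃ f ∈ D, H.IsLink f a b

lemma LinkedBy.symm {D : Set E} {a b : α} (h : LinkedBy H D a b) : LinkedBy H D b a := by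
  obtain ⟨f, hf, hl⟩ := h
  exact ⟨f, hf, hl.symm⟩

end LinkedBy

section Contraction

variable {α β E : Type*} {H : Graph α E} {D : Set E} {φ : α → β}

/-- `φ` identifies exactly the vertices of `H` that are connected by edges of `D`. -/
def IsContractionMap (H : Graph α E) (D : Set E) (φ : α → β) : Prop :=
  ∀ a ∈ V(H), ∀ b ∈ V(H), φ a = φ b ↔ Relation.EqvGen (LinkedBy H D) a b

/-- The vertices of `H` that `φ` maps into `L`. -/
def fiberOver (H : Graph α E) (φ : α → β) (L : Set β) : Set α := V(H) ∩ φ ⁻¹' L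

lemma IsContractionMap.eq_of_isLink (hφ : IsContractionMap H D φ) {f : E} (hf : f ∈ D) {a b : α}
    (h : H.IsLink f a b) : φ a = φ b :=
  (hφ a h.left_mem b h.right_mem).2 (.rel _ _ ⟨f, hf, h⟩)

/-- The edges of `D` connect the fiber, and a connected graph on `n` vertices has at least `n - 1`
edges. The auxiliary simple graph forgets loops and multiplicities, so its edges inject into `D`. -/
lemma ncard_fiberOver_singleton_le [Finite E] (hV : V(H).Finite) (hφ : IsContractionMap H D φ)
    {c : β} (hc : c ∈ φ '' V(H)) :
    (fiberOver H φ {c}).ncard ≤ (D ∩ edgesWithin H (fiberOver H φ {c})).ncard + 1 := by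
  classical
  set C := fiberOver H φ {c} with hC
  let S : SimpleGraph C := SimpleGraph.fromRel fun a b => LinkedBy H D a b
  have hfin : Finite C := (hV.subset inter_subset_left).to_subtype
  have hreach : ∀ a b, Relation.EqvGen (LinkedBy H D) a b → ∀ (ha : a ∈ C) (hb : b ∈ C),
      S.Reachable ⟨a, ha⟩ ⟨b, hb⟩ := by
    -- Membership in the fiber is part of the induction because the intermediate vertices of the
    -- chain are not known to lie in `C`.
    have key : ∀ a b, Relation.EqvGen (LinkedBy H D) a b → (a ∈ C ↔ b ∈ C) ∧
      ∀ (ha : a ∈ C) (hb : b ∈ C), S.Reachable ⟨a, ha⟩ ⟨b, hb⟩ := by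
      intro a b h
      induction h with
      | rel a b h =>
        obtain ⟨f, hf, hl⟩ := h
        refine ⟨by simp [hC, fiberOver, hl.left_mem, hl.right_mem, hφ.eq_of_isLink hf hl],
          fun ha hb => ?_⟩
        by_cases hab : a = b
        · subst hab; exact .refl _
        · exact SimpleGraph.Adj.reachable ⟨by simpa using hab, .inl ⟨f, hf, hl⟩⟩
      | refl a => exact ⟨Iff.rfl, fun _ _ => .refl _⟩
      | symm a b _ ih => exact ⟨ih.1.symm, fun ha hb => (ih.2 hb ha).symm⟩
      | trans a b c _ _ ih₁ ih₂ =>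
        exact ⟨ih₁.1.trans ih₂.1, fun ha hc =>
          (ih₁.2 ha (ih₁.1.1 ha)).trans (ih₂.2 (ih₁.1.1 ha) hc)⟩
    exact fun a b h => (key a b h).2
  have hconn : S.Connected := by
    obtain ⟨v, hv, rfl⟩ := hc
    have : Nonempty C := ⟨⟨v, hv, rfl⟩⟩
    refine ⟨fun a b => hreach a b ((hφ _ a.2.1 _ b.2.1).1 ?_) a.2 b.2⟩
    exact a.2.2.trans b.2.2.symm
  have h1 := hconn.card_vert_le_card_edgeSet_add_one
  have h2 : ∀ e : S.edgeSet, ∃ f : ↥(D ∩ edgesWithin H C), ∃ a b : C, H.IsLink f a b ∧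
      (e : Sym2 C) = s(a, b) := by
    rintro ⟨e, he⟩
    induction e using Sym2.ind with
    | _ a b =>
      obtain ⟨-, ⟨f, hf, hl⟩ | ⟨f, hf, hl⟩⟩ := (SimpleGraph.mem_edgeSet _).1 he
      · exact ⟨⟨f, hf, (mem_edgesWithin_iff hl).2 ⟨a.2, b.2⟩⟩, a, b, hl, rfl⟩
      · exact ⟨⟨f, hf, (mem_edgesWithin_iff hl).2 ⟨b.2, a.2⟩⟩, a, b, hl.symm, rfl⟩
  choose g hg using h2
  have hinj : Function.Injective g := by
    intro e e' hee
    obtain ⟨a, b, hl, he⟩ := hg e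
    obtain ⟨a', b', hl', he'⟩ := hg e'
    rw [← hee] at hl'
    refine Subtype.ext ?_
    rw [he, he']
    obtain ⟨h1, h2⟩ | ⟨h1, h2⟩ := hl.eq_and_eq_or_eq_and_eq hl'
    · rw [Subtype.ext h1, Subtype.ext h2]
    · rw [Subtype.ext h1, Subtype.ext h2, Sym2.eq_swap]
  have h3 := Nat.card_le_card_of_injective g hinj
  simp only [Nat.card_coe_set_eq] at h1 h3
  omega

lemma ncard_inter_edgesWithin_le [Fintype E] {x : E → ℝ} (hx : SatisfiesTreeConstraints H x)
    (hD : ∀ e ∈ D, x e = 1) {L : Set α} (hL : L ⊆ V(H)) (hne : L.Nonempty) :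
    ((D ∩ edgesWithin H L).ncard : ℝ) + wt x (edgesWithin H L \ D) ≤ (L.ncard : ℝ) - 1 := by
  have h := hx.le L hL hne
  have h2 : wt x (edgesWithin H L) = wt x (D ∩ edgesWithin H L) + wt x (edgesWithin H L \ D) := by
    rw [← wt_union (disjoint_sdiff_right.mono_left inter_subset_left), inter_comm,
      Set.inter_union_sdiff]
  rw [wt_eq_ncard (S := D ∩ _) fun e he => hD e he.1] at h2
  linarith

lemma edgesWithin_fiberOver_insert (hφ : IsContractionMap H D φ) (c : β) (L : Set β) :
    D ∩ edgesWithin H (fiberOver H φ (insert c L)) =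
      (D ∩ edgesWithin H (fiberOver H φ {c})) ∪ (D ∩ edgesWithin H (fiberOver H φ L)) := by
  ext f
  by_cases hf : f ∈ D ∧ f ∈ E(H)
  · obtain ⟨a, b, hl⟩ := Graph.exists_isLink_of_mem_edgeSet hf.2
    have := hφ.eq_of_isLink hf.1 hl
    simp [mem_edgesWithin_iff hl, fiberOver, hf.1, hl.left_mem, hl.right_mem, this]
  · have : ∀ L, f ∉ D ∩ edgesWithin H L := fun L h => hf ⟨h.1, edgesWithin_subset h.2⟩
    simp only [mem_union, this, or_self]

/-- Connectedness gives each fiber at least its size minus one edges of `D`; the tree constraint of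
the fiber, where these edges weigh 1 each, allows no more. No edge of `D` joins different fibers, so
the counts add up. -/
lemma ncard_fiberOver [Fintype E] (hV : V(H).Finite) (hφ : IsContractionMap H D φ)
    {x : E → ℝ} (hx : SatisfiesTreeConstraints H x) (hD : ∀ e ∈ D, x e = 1)
    {L : Set β} (hL : L ⊆ φ '' V(H)) :
    (fiberOver H φ L).ncard = L.ncard + (D ∩ edgesWithin H (fiberOver H φ L)).ncard := by
  have hfin : L.Finite := (hV.image φ).subset hL
  induction L, hfin using Set.Finite.induction_on with
  | empty =>
    have h0 : fiberOver H φ (∅ : Set β) = ∅ := by simp [fiberOver]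
    have h1 : D ∩ edgesWithin H (∅ : Set α) = ∅ := by
      ext f; simp [mem_edgesWithin]
    simp [h0, h1]
  | @insert c L hc hLf ih =>
    have ih := ih ((subset_insert _ _).trans hL)
    have hcV : c ∈ φ '' V(H) := hL (mem_insert _ _)
    have hsplit : fiberOver H φ (insert c L) = fiberOver H φ {c} ∪ fiberOver H φ L := by
      ext a; simp [fiberOver, and_or_left]
    have hdisj : Disjoint (fiberOver H φ {c}) (fiberOver H φ L) := by
      rw [Set.disjoint_left]
      rintro a ⟨-, ha⟩ ⟨-, ha'⟩
      exact hc (by simpa [show φ a = c from ha] using ha')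
    have hdisj' : Disjoint (D ∩ edgesWithin H (fiberOver H φ {c}))
        (D ∩ edgesWithin H (fiberOver H φ L)) := by
      rw [Set.disjoint_left]
      rintro f ⟨-, hf⟩ ⟨-, hf'⟩
      obtain ⟨a, b, hl, ha, hb⟩ := mem_edgesWithin.1 hf
      exact Set.disjoint_left.1 hdisj ha ((mem_edgesWithin_iff hl).1 hf').1
    have hf1 : (fiberOver H φ {c}).Finite := hV.subset inter_subset_left
    have hf2 : (fiberOver H φ L).Finite := hV.subset inter_subset_left
    rw [edgesWithin_fiberOver_insert hφ, Set.ncard_union_eq hdisj' (Set.toFinite _) (Set.toFinite _),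
      hsplit, Set.ncard_union_eq hdisj hf1 hf2, ih, Set.ncard_insert_of_notMem hc hLf]
    have h1 := ncard_fiberOver_singleton_le hV hφ hcV
    have h2 := ncard_inter_edgesWithin_le hx hD (L := fiberOver H φ {c}) inter_subset_left (by
      obtain ⟨a, ha, rfl⟩ := hcV
      exact ⟨a, ha, rfl⟩)
    have h3 : 0 ≤ wt x (edgesWithin H (fiberOver H φ {c}) \ D) :=
      wt_nonneg fun e he => hx.nonneg e (edgesWithin_subset he.1)
    have h4 : (D ∩ edgesWithin H (fiberOver H φ {c})).ncard + 1 ≤ (fiberOver H φ {c}).ncard := by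
      have : ((D ∩ edgesWithin H (fiberOver H φ {c})).ncard : ℝ) + 1 ≤
        (fiberOver H φ {c}).ncard := by linarith
      exact_mod_cast this
    omega

lemma contract_isLink {f : E} {c d : β} : ((H.deleteEdges D).map φ).IsLink f c d ↔
    f ∉ D ∧ ∃ a b, H.IsLink f a b ∧ φ a = c ∧ φ b = d := by
  simp only [Graph.map_isLink, Relation.map_apply, Graph.deleteEdges_isLink]
  grind

lemma contract_edgeSet : E((H.deleteEdges D).map φ) = E(H) \ D := by
  simp

lemma contract_vertexSet : V((H.deleteEdges D).map φ) = φ '' V(H) := by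
  simp

lemma contract_edgesWithin (L : Set β) : edgesWithin ((H.deleteEdges D).map φ) L =
    edgesWithin H (fiberOver H φ L) \ D := by
  ext f
  simp only [mem_edgesWithin, mem_sdiff, contract_isLink, fiberOver, mem_inter_iff, mem_preimage]
  constructor
  · rintro ⟨c, d, ⟨hf, a, b, hl, rfl, rfl⟩, hc, hd⟩
    exact ⟨⟨a, b, hl, ⟨hl.left_mem, hc⟩, ⟨hl.right_mem, hd⟩⟩, hf⟩
  · rintro ⟨⟨a, b, hl, ⟨-, ha⟩, ⟨-, hb⟩⟩, hf⟩
    exact ⟨_, _, ⟨hf, a, b, hl, rfl, rfl⟩, ha, hb⟩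

/-- The constraint for `L` is that for its preimage: passing to the preimage raises the number of
vertices and the weight by the same number of contracted edges. -/
lemma SatisfiesTreeConstraints.contract [Fintype E] (hV : V(H).Finite)
    (hφ : IsContractionMap H D φ) {x : E → ℝ} (hx : SatisfiesTreeConstraints H x)
    (hDE : D ⊆ E(H)) (hD : ∀ e ∈ D, x e = 1) :
    SatisfiesTreeConstraints ((H.deleteEdges D).map φ) x ∧
      V(H).ncard = V((H.deleteEdges D).map φ).ncard + D.ncard := by
  have hall : fiberOver H φ (φ '' V(H)) = V(H) :=
    inter_eq_left.2 (subset_preimage_image φ _)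
  have hcard := ncard_fiberOver hV hφ hx hD (L := φ '' V(H)) subset_rfl
  rw [hall, edgesWithin_vertexSet, inter_eq_left.2 hDE] at hcard
  refine ⟨⟨?_, ?_, ?_⟩, by rw [contract_vertexSet, hcard]⟩
  · rw [contract_edgeSet]
    exact fun e he => hx.nonneg e he.1
  · rw [contract_edgeSet, contract_vertexSet, wt_diff hDE, hx.total, wt_eq_ncard hD, hcard]
    push_cast; ring
  · intro L hL hne
    rw [contract_vertexSet] at hL
    have h := ncard_inter_edgesWithin_le hx hD (L := fiberOver H φ L) inter_subset_left (by
      obtain ⟨c, hc⟩ := hne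
      obtain ⟨a, ha, rfl⟩ := hL hc
      exact ⟨a, ha, hc⟩)
    rw [ncard_fiberOver hV hφ hx hD hL, ← contract_edgesWithin] at h
    push_cast at h
    linarith

end Contraction

section Deletion

variable {α E : Type*} [Fintype E] {H : Graph α E} {x : E → ℝ} {Z : Set E}

lemma wt_diff_of_eq_zero (hZ : ∀ e ∈ Z, x e = 0) (S : Set E) : wt x (S \ Z) = wt x S := by
  rw [← Set.sdiff_self_inter, wt_diff inter_subset_left, wt_eq_zero (S := S ∩ Z)]
  · ring
  · exact fun e he => hZ e he.2

lemma SatisfiesTreeConstraints.delete (hx : SatisfiesTreeConstraints H x)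
    (hZ : ∀ e ∈ Z, x e = 0) : SatisfiesTreeConstraints (H.deleteEdges Z) x := by
  refine ⟨fun e he => hx.nonneg e ?_, ?_, fun L hL hne => ?_⟩
  · rw [Graph.edgeSet_deleteEdges] at he
    exact he.1
  · rw [Graph.edgeSet_deleteEdges, wt_diff_of_eq_zero hZ, hx.total, Graph.vertexSet_deleteEdges]
  · rw [delete_edgesWithin, wt_diff_of_eq_zero hZ]
    exact hx.le L hL hne

lemma QReachable.delete {Q : Set α} (h : QReachable H x Q) (hZ : ∀ e ∈ Z, x e = 0) :
    QReachable (H.deleteEdges Z) x Q := by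
  induction h with
  | empty => exact .empty
  | add Q w _ hw ih =>
    refine .add Q w ih ⟨hw.1, hw.2.1, ?_⟩
    rw [← hw.2.2, delete_edgesWithin, Graph.vertexSet_deleteEdges,
      ← wt_diff_of_eq_zero hZ (H.incidenceSet w ∩ _)]
    congr 1
    ext f
    simp [Graph.mem_incidenceSet]
    tauto

end Deletion

/-! ### The construction of `Q`: tightness, stability and confluence -/

section Reachable

variable {α E : Type*} [Fintype E] {H : Graph α E} {x y : E → ℝ} {Q : Set α}

lemma QReachable.subset (h : QReachable H x Q) : Q ⊆ V(H) := by
  induction h with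
  | empty => exact empty_subset _
  | add Q w _ hw ih => exact insert_subset hw.1 ih

/-- Each step removes one node and weight exactly 1 from the rest, so both sides of the tight
equation drop by 1. -/
lemma QReachable.isTight (h : QReachable H x Q) (hV : V(H).Finite) (hne : V(H).Nonempty)
    (htot : wt x E(H) = (V(H).ncard : ℝ) - 1) (hloop : ∀ f a, ¬ H.IsLink f a a) :
    IsTight H x (V(H) \ Q) := by
  induction h with
  | empty => simpa [IsTight, edgesWithin_vertexSet] using ⟨hne, htot⟩
  | add Q w hQ hw ih =>
    have hws := wt_edgesWithin_diff_singleton (H := H) (L := V(H) \ Q) x w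
    have heq : V(H) \ insert w Q = (V(H) \ Q) \ {w} := by ext; simp; tauto
    have hwm : w ∈ V(H) \ Q := ⟨hw.1, hw.2.1⟩
    rw [heq]
    refine ⟨sdiff_subset.trans sdiff_subset, ?_, ?_⟩
    -- If `w` were the last node left, no loopless edge would remain, and the weight would be 0
    -- instead of 1.
    · by_contra hemp
      rw [Set.not_nonempty_iff_eq_empty, Set.sdiff_eq_empty] at hemp
      have : edgesWithin H (V(H) \ Q) = ∅ := by
        ext f
        simp only [mem_edgesWithin, mem_empty_iff_false, iff_false]
        rintro ⟨a, b, hl, ha, hb⟩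
        rw [show a = w from hemp ha, show b = w from hemp hb] at hl
        exact hloop _ _ hl
      have h1 := hw.2.2
      rw [this, inter_empty, wt_empty] at h1
      norm_num at h1
    · rw [hw.2.2, ih.2.2] at hws
      have := Set.ncard_sdiff_singleton_add_one hwm (hV.subset sdiff_subset)
      rw [← this] at hws
      push_cast at hws
      linarith

/-- The weight tested in a step is the difference of the weights of two consecutive complements of
`Q`, and both are tight sets. -/
lemma QReachable.of_eq_on_tight (h : QReachable H x Q) (hV : V(H).Finite) (hne : V(H).Nonempty)
    (htot : wt x E(H) = (V(H).ncard : ℝ) - 1) (hloop : ∀ f a, ¬ H.IsLink f a a)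
    (hxy : ∀ L, IsTight H x L → wt y (edgesWithin H L) = wt x (edgesWithin H L)) :
    QReachable H y Q := by
  induction h with
  | empty => exact .empty
  | add Q w hQ hw ih =>
    refine .add Q w ih ⟨hw.1, hw.2.1, ?_⟩
    have h1 := hxy _ (hQ.isTight hV hne htot hloop)
    have h2 := hxy _ ((QReachable.add Q w hQ hw).isTight hV hne htot hloop)
    have heq : V(H) \ insert w Q = (V(H) \ Q) \ {w} := by ext; simp; tauto
    rw [heq] at h2
    rw [wt_edgesWithin_diff_singleton, h1, h2, ← wt_edgesWithin_diff_singleton, hw.2.2]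

/-- Every edge incident to a vertex of a reachable set is incident to a vertex of the final result
of the construction. -/
lemma IsQ.exists_inc {Q' : Set α} (hQ' : IsQ H x Q') (h : QReachable H x Q) (hV : V(H).Finite)
    (hne : V(H).Nonempty) (hx : SatisfiesTreeConstraints H x) (hloop : ∀ f a, ¬ H.IsLink f a a)
    {f : E} (hf : ∃ q ∈ Q, H.Inc f q) : ∃ q ∈ Q', H.Inc f q := by
  have htight := hQ'.1.isTight hV hne hx.total hloop
  -- With at most one node left outside `Q'`, inclusion of `Q` may fail because different last nodes
  -- can remain, but every edge is covered as there are no loops.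
  by_cases hsub : (V(H) \ Q').Subsingleton
  · obtain ⟨q, -, hq⟩ := hf
    obtain ⟨a, b, hl⟩ := Graph.exists_isLink_of_mem_edgeSet hq.edge_mem
    by_contra! hcon
    have hab := hsub ⟨hl.left_mem, fun h => hcon a h hl.inc_left⟩
      ⟨hl.right_mem, fun h => hcon b h hl.inc_right⟩
    subst hab
    exact hloop _ _ hl
  · suffices Q ⊆ Q' by
      obtain ⟨q, hq, hi⟩ := hf
      exact ⟨q, this hq, hi⟩
    clear hf
    induction h with
    | empty => exact empty_subset _
    | add Q w hQ hw ih =>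
      refine insert_subset ?_ ih
      by_contra hwQ
      -- The weight from `w` into the complement of `Q'` is at most 1 because that complement is
      -- smaller than the one of `Q`. It is at least 1 because the complement of `Q'` is tight and
      -- stays nonempty without `w`.
      refine hQ'.2 w ⟨hw.1, hwQ, le_antisymm ?_ ?_⟩
      · rw [← hw.2.2]
        exact wt_mono (inter_subset_inter_right _ (edgesWithin_mono (sdiff_subset_sdiff_right ih)))
          fun e he => hx.nonneg e (edgesWithin_subset he.2)
      · rw [wt_edgesWithin_diff_singleton, htight.2.2]
        have hwm : w ∈ V(H) \ Q' := ⟨hw.1, hwQ⟩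
        have h1 := hx.le ((V(H) \ Q') \ {w}) (sdiff_subset.trans sdiff_subset) (by
          obtain ⟨b, hb, hbw⟩ := (Set.not_subsingleton_iff.1 hsub).exists_ne w
          exact ⟨b, hb, hbw⟩)
        have := Set.ncard_sdiff_singleton_add_one hwm (hV.subset sdiff_subset)
        rw [← this]
        push_cast
        linarith

end Reachable

section ReachableContraction

variable {α β E : Type*} [Fintype E] {H : Graph α E} {x : E → ℝ} {Q : Set α} {D : Set E}
  {φ : α → β}

/-- The map `ρ` strengthens the induction: it collapses the edges of `D` touching `Q` while fixing
all vertices outside `Q`. Hence these edges alone never identify two different vertices outside `Q`.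
-/
lemma QReachable.contract [DecidableEq α] (h : QReachable H x Q) (hφ : IsContractionMap H D φ)
    (hpos : ∀ e ∈ E(H), 0 < x e) (hD : ∀ e, e ∈ D ↔ e ∈ E(H) ∧ x e = 1) :
    ∃ Q₁, QReachable ((H.deleteEdges D).map φ) x Q₁ ∧
      (∀ f, f ∉ D → (∃ q ∈ Q, H.Inc f q) → ∃ q ∈ Q₁, ((H.deleteEdges D).map φ).Inc f q) ∧
      (∀ a ∈ V(H), φ a ∈ Q₁ → a ∈ Q) ∧
      ∃ ρ : α → α, (∀ a, a ∉ Q → ρ a = a) ∧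
        ∀ f ∈ D, ∀ a b, H.IsLink f a b → a ∈ Q ∨ b ∈ Q → ρ a = ρ b := by
  induction h with
  | empty => exact ⟨∅, .empty, by simp, by simp, id, by simp, by simp⟩
  | add Q w hQ hw ih =>
    obtain ⟨Q₁, hQ₁, hcov, hsub, ρ, hρ, hρD⟩ := ih
    set A := H.incidenceSet w ∩ edgesWithin H (V(H) \ Q) with hA
    have hAE : A ⊆ E(H) := fun f hf => edgesWithin_subset hf.2
    -- If `w` has an edge of `D` into the rest, positivity and total weight 1 make it the only edge
    -- there. It disappears in the contraction, so `Q₁` need not grow.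
    by_cases hex : ∃ f ∈ A, f ∈ D
    · obtain ⟨f, hfA, hfD⟩ := hex
      have hAf : ∀ g ∈ A, g = f := by
        intro g hg
        by_contra hgf
        have h1 : wt x {g, f} ≤ wt x A := wt_mono (by
          rintro e (rfl | rfl)
          exacts [hg, hfA]) fun e he => (hpos e (hAE he)).le
        have h2 : wt x {g, f} = x g + x f := by
          rw [Set.insert_eq, wt_union (by simpa using hgf), wt_singleton, wt_singleton]
        have h3 := hpos g (hAE hg)
        have h4 := ((hD f).1 hfD).2
        have h5 : wt x A = 1 := hw.2.2
        linarith
      obtain ⟨u, hu⟩ : H.Inc f w := hfA.1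
      obtain ⟨hwL, huL⟩ := (mem_edgesWithin_iff hu).1 hfA.2
      -- Everything that `ρ` sent to `w` is redirected along the unique edge to `u`, which is still
      -- outside the enlarged set.
      refine ⟨Q₁, hQ₁, ?_, fun a ha h => mem_insert_of_mem _ (hsub a ha h),
        fun a => if ρ a = w then u else ρ a, ?_, ?_⟩
      · rintro g hg ⟨q, rfl | hq, hi⟩
        · refine hcov g hg ?_
          by_contra! hcon
          obtain ⟨b, hb⟩ := hi
          refine hg (hAf g ⟨hb.inc_left, (mem_edgesWithin_iff hb).2
            ⟨⟨hb.left_mem, fun h => hcon _ h hb.inc_left⟩,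
              ⟨hb.right_mem, fun h => hcon _ h hb.inc_right⟩⟩⟩ ▸ hfD)
        · exact hcov g hg ⟨q, hq, hi⟩
      · intro a ha
        have h1 := hρ a fun h => ha (mem_insert_of_mem _ h)
        have h2 : a ≠ w := fun h => ha (h ▸ mem_insert _ _)
        simp [h1, h2]
      · intro g hg a b hl hab
        by_cases hQab : a ∈ Q ∨ b ∈ Q
        · simp only [hρD g hg a b hl hQab]
        · push Not at hQab
          have hgA : g ∈ A := by
            refine ⟨?_, (mem_edgesWithin_iff hl).2 ⟨⟨hl.left_mem, hQab.1⟩, hl.right_mem, hQab.2⟩⟩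
            rcases hab with (rfl | h) | (rfl | h)
            exacts [hl.inc_left, absurd h hQab.1, hl.inc_right, absurd h hQab.2]
          rw [hAf g hgA] at hl
          have e1 := hρ w hw.2.1
          have e2 := hρ u huL.2
          obtain ⟨rfl, rfl⟩ | ⟨rfl, rfl⟩ := hl.eq_and_eq_or_eq_and_eq hu <;> simp [e1, e2]
    · push Not at hex
      -- Here no edge of `D` joins `w` to another vertex outside `Q`, so having `ρ`-value `w` is
      -- invariant along `D`. Thus `w` is the only vertex outside `Q` in its class, and the weight
      -- tested at `φ w` is the one tested at `w`.
      have hclass : ∀ a ∈ V(H), φ a = φ w → a ∉ Q → a = w := by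
        have key : ∀ a b, Relation.EqvGen (LinkedBy H D) a b → (ρ a = w ↔ ρ b = w) := by
          intro a b h
          induction h with
          | rel a b h =>
            obtain ⟨g, hg, hl⟩ := h
            by_cases hQab : a ∈ Q ∨ b ∈ Q
            · rw [hρD g hg a b hl hQab]
            · push Not at hQab
              have hgw : g ∈ edgesWithin H (V(H) \ Q) :=
                (mem_edgesWithin_iff hl).2 ⟨⟨hl.left_mem, hQab.1⟩, hl.right_mem, hQab.2⟩
              rw [hρ a hQab.1, hρ b hQab.2]
              refine iff_of_false ?_ ?_
              · rintro rfl
                exact hex g ⟨hl.inc_left, hgw⟩ hg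
              · rintro rfl
                exact hex g ⟨hl.inc_right, hgw⟩ hg
          | refl a => exact Iff.rfl
          | symm a b _ ih => exact ih.symm
          | trans a b c _ _ ih₁ ih₂ => exact ih₁.trans ih₂
        intro a ha hφa haQ
        rw [← hρ a haQ]
        exact (key a w ((hφ a ha w hw.1).1 hφa)).2 (hρ w hw.2.1)
      refine ⟨insert (φ w) Q₁, .add Q₁ _ hQ₁ ⟨?_, ?_, ?_⟩, ?_, ?_, ρ, ?_, ?_⟩
      · rw [contract_vertexSet]; exact ⟨w, hw.1, rfl⟩
      · exact fun h => hw.2.1 (hsub w hw.1 h)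
      · rw [← hw.2.2]
        congr 1
        ext f
        constructor
        · rintro ⟨⟨c, hc⟩, hf⟩
          obtain ⟨hwL, hcL⟩ := (mem_edgesWithin_iff hc).1 hf
          obtain ⟨hfD, a, b, hl, ha, rfl⟩ := contract_isLink.1 hc
          have hnQ : ∀ q ∈ Q, ¬ H.Inc f q := by
            intro q hq hi
            obtain ⟨d, hd, hid⟩ := hcov f hfD ⟨q, hq, hi⟩
            rcases hid.eq_or_eq_of_isLink hc with rfl | rfl
            exacts [hwL.2 hd, hcL.2 hd]
          have haw := hclass a hl.left_mem ha fun h => hnQ a h hl.inc_left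
          subst haw
          exact ⟨hl.inc_left, (mem_edgesWithin_iff hl).2 ⟨⟨hl.left_mem, hw.2.1⟩, hl.right_mem,
            fun h => hnQ b h hl.inc_right⟩⟩
        · intro hf
          obtain ⟨u, hu⟩ : H.Inc f w := hf.1
          obtain ⟨hwL, huL⟩ := (mem_edgesWithin_iff hu).1 hf.2
          have hl : ((H.deleteEdges D).map φ).IsLink f (φ w) (φ u) :=
            contract_isLink.2 ⟨hex f hf, w, u, hu, rfl, rfl⟩
          exact ⟨hl.inc_left, (mem_edgesWithin_iff hl).2
            ⟨⟨hl.left_mem, fun h => hw.2.1 (hsub w hw.1 h)⟩, hl.right_mem,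
              fun h => huL.2 (hsub u huL.1 h)⟩⟩
      · rintro f hf ⟨q, rfl | hq, hi⟩
        · refine ⟨φ q, mem_insert _ _, ?_⟩
          obtain ⟨b, hb⟩ := hi
          exact ⟨φ b, contract_isLink.2 ⟨hf, q, b, hb, rfl, rfl⟩⟩
        · obtain ⟨d, hd, hid⟩ := hcov f hf ⟨q, hq, hi⟩
          exact ⟨d, mem_insert_of_mem _ hd, hid⟩
      · rintro a ha (h | h)
        · by_cases haQ : a ∈ Q
          · exact mem_insert_of_mem _ haQ
          · rw [hclass a ha h haQ]; exact mem_insert _ _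
        · exact mem_insert_of_mem _ (hsub a ha h)
      · exact fun a ha => hρ a fun h => ha (mem_insert_of_mem _ h)
      · intro g hg a b hl hab
        refine hρD g hg a b hl ?_
        by_contra! hQab
        have hgw : g ∈ edgesWithin H (V(H) \ Q) :=
          (mem_edgesWithin_iff hl).2 ⟨⟨hl.left_mem, hQab.1⟩, hl.right_mem, hQab.2⟩
        rcases hab with (rfl | h) | (rfl | h)
        exacts [hex g ⟨hl.inc_left, hgw⟩ hg, hQab.1 h, hex g ⟨hl.inc_right, hgw⟩ hg, hQab.2 h]

end ReachableContraction

/-! ### Free elements and matroid polytopes under deletion and contraction -/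

section FreeElements

variable {E : Type*} {M : Matroid E}

lemma IsFreeElement.delete {f : E} (hf : IsFreeElement M f) {Z : Set E} (hfZ : f ∉ Z) :
    IsFreeElement (M.delete Z) f := by
  refine ⟨⟨hf.1, hfZ⟩, fun I hI => ?_⟩
  rw [Matroid.delete_indep_iff] at hI ⊢
  exact ⟨hf.2 I hI.1, Set.disjoint_insert_left.2 ⟨hfZ, hI.2⟩⟩

lemma contract_indep_iff_of_indep {D I : Set E} (hD : M.Indep (D ∩ M.E)) :
    (M.contract D).Indep I ↔ Disjoint I (D ∩ M.E) ∧ M.Indep (I ∪ D ∩ M.E) := by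
  rw [← Matroid.contract_inter_ground_eq, hD.contract_indep_iff]

lemma IsFreeElement.contract {f : E} (hf : IsFreeElement M f) {D : Set E}
    (hD : M.Indep (D ∩ M.E)) (hfD : f ∉ D) : IsFreeElement (M.contract D) f := by
  refine ⟨⟨hf.1, hfD⟩, fun I hI => ?_⟩
  rw [contract_indep_iff_of_indep hD] at hI ⊢
  exact ⟨Set.disjoint_insert_left.2 ⟨fun h => hfD h.1, hI.1⟩, by
    rw [Set.insert_union]; exact hf.2 _ hI.2⟩

end FreeElements

section Polytope

variable {E : Type*} [Fintype E] {M N : Matroid E} {x : E → ℝ}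

lemma ncard_le_ncard_of_isBasis {J K X : Set E} (hJ : M.Indep J) (hJX : J ⊆ X)
    (hK : M.IsBasis K X) : J.ncard ≤ K.ncard := by
  have h := hJ.encard_le_eRk_of_subset hJX
  rw [← hK.encard_eq_eRk, ← (Set.toFinite J).cast_ncard_eq, ← (Set.toFinite K).cast_ncard_eq] at h
  exact_mod_cast h

/-- This and its converse `mem_matroidPolytope_of_exists_indep` replace rank inequalities by
explicit independent sets. -/
lemma exists_indep_of_mem_matroidPolytope (hx : x ∈ matroidPolytope M) {I S : Set E}
    (hI : M.Indep I) (hIS : I ⊆ S) (hS : S ⊆ M.E) :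
    ∃ J, M.IsBasis J S ∧ I ⊆ J ∧ wt x S ≤ J.ncard := by
  obtain ⟨J, hJ, hIJ⟩ := hI.subset_isBasis_of_subset hIS hS
  refine ⟨J, hJ, hIJ, ?_⟩
  have h := hx.2 S hS
  rwa [← hJ.encard_eq_eRk, ← Set.ncard_def] at h

lemma mem_matroidPolytope_of_exists_indep (h0 : ∀ e ∈ M.E, 0 ≤ x e)
    (h : ∀ S ⊆ M.E, ∃ I ⊆ S, M.Indep I ∧ wt x S ≤ I.ncard) : x ∈ matroidPolytope M := by
  refine ⟨h0, fun S hS => ?_⟩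
  obtain ⟨I, hIS, hI, hle⟩ := h S hS
  obtain ⟨J, hJ⟩ := M.exists_isBasis S hS
  refine hle.trans ?_
  rw [← hJ.encard_eq_eRk, ← Set.ncard_def]
  exact_mod_cast ncard_le_ncard_of_isBasis hI hIS hJ

lemma indep_of_mem_matroidPolytope (hx : x ∈ matroidPolytope M) {S : Set E} (hS : S ⊆ M.E)
    (h1 : ∀ e ∈ S, x e = 1) : M.Indep S := by
  obtain ⟨J, hJ, -, hle⟩ := exists_indep_of_mem_matroidPolytope hx M.empty_indep
    (empty_subset S) hS
  rw [wt_eq_ncard h1] at hle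
  have := Set.eq_of_subset_of_ncard_le hJ.subset (by exact_mod_cast hle)
  exact this ▸ hJ.indep

lemma mem_matroidPolytope_delete (hx : x ∈ matroidPolytope M) (Z : Set E) :
    x ∈ matroidPolytope (M.delete Z) := by
  refine mem_matroidPolytope_of_exists_indep (fun e he => hx.1 e he.1) fun S hS => ?_
  obtain ⟨J, hJ, -, hle⟩ := exists_indep_of_mem_matroidPolytope hx M.empty_indep
    (empty_subset S) (hS.trans sdiff_subset)
  refine ⟨J, hJ.subset, Matroid.delete_indep_iff.2 ⟨hJ.indep, ?_⟩, hle⟩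
  exact Set.disjoint_left.2 fun e he => (hS (hJ.subset he)).2

/-- Extend the contracted edges, which are independent, to a basis of their union with `S`. Dropping
them costs exactly their weight. -/
lemma mem_matroidPolytope_contract (hx : x ∈ matroidPolytope M) {D : Set E}
    (hD : ∀ e ∈ D, x e = 1) : x ∈ matroidPolytope (M.contract D) := by
  have hDi : M.Indep (D ∩ M.E) :=
    indep_of_mem_matroidPolytope hx inter_subset_right fun e he => hD e he.1
  refine mem_matroidPolytope_of_exists_indep (fun e he => hx.1 e he.1) fun S hS => ?_
  have hdisj : Disjoint (D ∩ M.E) S := Set.disjoint_left.2 fun e he h => (hS h).2 he.1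
  obtain ⟨J, hJ, hDJ, hle⟩ := exists_indep_of_mem_matroidPolytope hx hDi
    (subset_union_left (t := S)) (union_subset inter_subset_right (hS.trans sdiff_subset))
  refine ⟨J \ (D ∩ M.E), ?_, ?_, ?_⟩
  · rintro e ⟨he, heD⟩
    exact (hJ.subset he).resolve_left heD
  · rw [contract_indep_iff_of_indep hDi, Set.sdiff_union_of_subset hDJ]
    exact ⟨disjoint_sdiff_left, hJ.indep⟩
  · rw [wt_union hdisj, wt_eq_ncard (S := D ∩ M.E) fun e he => hD e he.1,
      ← Set.ncard_sdiff_add_ncard_of_subset hDJ] at hle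
    push_cast at hle
    linarith

end Polytope

/-! ### Reduction of node constraints to single vertices -/

section NodeConstraint

variable {V E : Type*} {N : V → Matroid E} {w : Set V}

open scoped Function in
/-- The constraints of the vertices contained in `w` have disjoint ground sets. -/
def DisjointGrounds (N : V → Matroid E) (w : Set V) : Prop :=
  Pairwise (Disjoint on fun v : w => (N v).E)

lemma DisjointGrounds.eq_of_mem (h : DisjointGrounds N w) {u v : V} (hu : u ∈ w) (hv : v ∈ w)
    {f : E} (hfu : f ∈ (N u).E) (hfv : f ∈ (N v).E) : u = v := by
  by_contra huv
  exact Set.disjoint_left.1 (h (i := ⟨u, hu⟩) (j := ⟨v, hv⟩) (by simpa using huv)) hfu hfv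

lemma nodeConstraint_indep_iff (h : DisjointGrounds N w) {I : Set E} :
    (nodeConstraint N w).Indep I ↔
      (∀ v ∈ w, (N v).Indep (I ∩ (N v).E)) ∧ I ⊆ (nodeConstraint N w).E := by
  have h' := h
  unfold DisjointGrounds at h'
  rw [nodeConstraint, dif_pos h', Matroid.disjointSigma_indep_iff, Matroid.disjointSigma_ground_eq]
  simp

lemma mem_nodeConstraint_ground (h : DisjointGrounds N w) {f : E} :
    f ∈ (nodeConstraint N w).E ↔ ∃ v ∈ w, f ∈ (N v).E := by
  have h' := h
  unfold DisjointGrounds at h'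
  rw [nodeConstraint, dif_pos h', Matroid.disjointSigma_ground_eq]
  simp

lemma nodeConstraint_indep_iff_of_subset (h : DisjointGrounds N w) {v : V} (hv : v ∈ w)
    {I : Set E} (hI : I ⊆ (N v).E) : (nodeConstraint N w).Indep I ↔ (N v).Indep I := by
  rw [nodeConstraint_indep_iff h]
  constructor
  · intro h1
    have := h1.1 v hv
    rwa [inter_eq_left.2 hI] at this
  · intro h1
    refine ⟨fun u hu => ?_, fun f hf => (mem_nodeConstraint_ground h).2 ⟨v, hv, hI hf⟩⟩
    by_cases huv : u = v
    · subst huv; rwa [inter_eq_left.2 hI]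
    · convert (N u).empty_indep
      rw [← Set.disjoint_iff_inter_eq_empty, Set.disjoint_left]
      exact fun f hf hfu => huv (h.eq_of_mem hu hv hfu (hI hf))

lemma isFreeElement_nodeConstraint_iff (h : DisjointGrounds N w) {v : V} (hv : v ∈ w) {f : E}
    (hf : f ∈ (N v).E) : IsFreeElement (nodeConstraint N w) f ↔ IsFreeElement (N v) f := by
  constructor
  · refine fun h1 => ⟨hf, fun I hI => ?_⟩
    have h2 := h1.2 I ((nodeConstraint_indep_iff_of_subset h hv hI.subset_ground).2 hI)
    exact (nodeConstraint_indep_iff_of_subset h hv (insert_subset hf hI.subset_ground)).1 h2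
  · refine fun h1 => ⟨(mem_nodeConstraint_ground h).2 ⟨v, hv, hf⟩, fun I hI => ?_⟩
    rw [nodeConstraint_indep_iff h] at hI ⊢
    refine ⟨fun u hu => ?_, insert_subset ((mem_nodeConstraint_ground h).2 ⟨v, hv, hf⟩) hI.2⟩
    by_cases huv : u = v
    · subst huv
      rw [Set.insert_inter_of_mem hf]
      exact h1.2 _ (hI.1 u hu)
    · rw [Set.insert_inter_of_notMem fun hfu => huv (h.eq_of_mem hu hv hfu hf)]
      exact hI.1 u hu

lemma mem_matroidPolytope_of_nodeConstraint [Fintype E] {x : E → ℝ} (h : DisjointGrounds N w)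
    (hx : x ∈ matroidPolytope (nodeConstraint N w)) {v : V} (hv : v ∈ w) :
    x ∈ matroidPolytope (N v) := by
  have hsub : (N v).E ⊆ (nodeConstraint N w).E :=
    fun f hf => (mem_nodeConstraint_ground h).2 ⟨v, hv, hf⟩
  refine mem_matroidPolytope_of_exists_indep (fun e he => hx.1 e (hsub he)) fun S hS => ?_
  obtain ⟨J, hJ, -, hle⟩ := exists_indep_of_mem_matroidPolytope hx
    (Matroid.empty_indep _) (empty_subset S) (hS.trans hsub)
  exact ⟨J, hJ.subset,
    (nodeConstraint_indep_iff_of_subset h hv (hJ.subset.trans hS)).1 hJ.indep, hle⟩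

end NodeConstraint

/-! ### Properties of the removal operations -/

section Removal

variable {V E : Type*} [Fintype E] {x : E → ℝ} {U : Set E}

/-- What is used about a removal operation at the node `w`, in terms of the constraints of the
single vertices. -/
structure VertexwiseRemoval (x : E → ℝ) (w : Set V) (U : Set E) (N N' : V → Matroid E) : Prop where
  ground : ∀ v ∈ w, (N' v).E = (N v).E
  free : ∀ v ∈ w, ∀ f ∈ U, f ∈ (N v).E → IsFreeElement (N' v) f
  transform : ∀ v ∈ w, ∀ I, (N' v).Indep I → ∃ R ⊆ I, R.ncard ≤ 4 ∧ (N v).Indep (I \ R)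
  feasible : ∀ v ∈ w, x ∈ matroidPolytope (N' v)
  unchanged : ∀ v, v ∉ w ∨ Disjoint (N v).E U → N' v = N v
  stays_free : ∀ v ∈ w, ∀ f, IsFreeElement (N v) f → IsFreeElement (N' v) f

lemma IsAdmissibleRemoval.vertexwise {w : Set V} {N N' : V → Matroid E}
    (h : IsAdmissibleRemoval x w U N N') (hN : DisjointGrounds N w)
    (hU : (U.ncard : ℝ) - wt x U ≤ 4) : VertexwiseRemoval x w U N N' := by
  have hN' : DisjointGrounds N' w := by
    intro a b hab
    have := hN hab
    simp only [Function.onFun] at this ⊢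
    rwa [h.ground a a.2, h.ground b b.2]
  refine ⟨h.ground, fun v hv f hf hfv => ?_, fun v hv I hI => ?_,
    fun v hv => mem_matroidPolytope_of_nodeConstraint hN' h.feasible hv, h.unchanged, h.stays_free⟩
  · have hfv' : f ∈ (N' v).E := by rwa [h.ground v hv]
    refine ⟨hfv', fun I hI => ?_⟩
    have h1 := h.free I ((nodeConstraint_indep_iff_of_subset hN' hv hI.subset_ground).2 hI)
    refine (nodeConstraint_indep_iff_of_subset hN' hv (insert_subset hfv' hI.subset_ground)).1
      (h1.subset ?_)
    exact insert_subset (.inr hf) subset_union_left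
  · obtain ⟨R, hR, hc, hi⟩ := h.transform v hv I hI
    refine ⟨R, hR, ?_, hi⟩
    have : ⌈(U.ncard : ℝ) - wt x U⌉ ≤ 4 := Int.ceil_le.2 (by exact_mod_cast hU)
    omega

variable {N N' : Matroid E}

/-- The independent sets of the matroid that results from the explicit removal procedure. -/
lemma IsVertexRemoval.exists_union (h : IsVertexRemoval x U N N') (hx : x ∈ matroidPolytope N) :
    ∃ M₂ : Matroid E, M₂.E = N.E ∧ M₂.Indep (N.E ∩ U) ∧
      (∀ J, M₂.Indep J ↔ ∃ I₁ I₂, (I₁ ⊆ N.E ∩ U ∧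
        (I₁.ncard : ℤ) ≤ ((N.E ∩ U).ncard : ℤ) - ⌊wt x (N.E ∩ U)⌋) ∧ N.Indep I₂ ∧ J = I₁ ∪ I₂) ∧
      N'.E = N.E ∧ ∀ I, N'.Indep I ↔ M₂.Indep (I ∪ N.E ∩ U) := by
  obtain ⟨M₁, M₂, hE, hM₁, ⟨hME, hM₂⟩, hN'⟩ := h
  set S := N.E ∩ U with hS
  rw [hE, union_self] at hME
  simp only [hM₁] at hM₂
  have hSE : S ⊆ N.E := inter_subset_left
  have hSi : M₂.Indep S := by
    obtain ⟨J, hJ, -, hle⟩ := exists_indep_of_mem_matroidPolytope hx N.empty_indep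
      (empty_subset S) hSE
    -- A basis `J` of `S` in `N` has at least `⌊x(S)⌋` elements, so the rest of `S` fits into `M₁`.
    refine (hM₂ S).2 ⟨S \ J, J, ⟨sdiff_subset, ?_⟩, hJ.indep, (Set.sdiff_union_of_subset hJ.subset).symm⟩
    have h2 := Set.ncard_sdiff_add_ncard_of_subset hJ.subset
    have h3 : ⌊wt x S⌋ ≤ (J.ncard : ℤ) := by
      have := (Int.floor_le (wt x S)).trans hle
      exact_mod_cast this
    omega
  refine ⟨M₂, hME, hSi, hM₂, ?_, fun I => ?_⟩
  · rw [hN', Matroid.disjointSum_ground_eq, Matroid.contract_ground, Matroid.freeOn_ground, hME,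
      Set.sdiff_union_of_subset hSE]
  · rw [hN', Matroid.disjointSum_indep_iff, Matroid.contract_ground, Matroid.freeOn_ground,
      Matroid.freeOn_indep_iff, hSi.contract_indep_iff, hME, Set.sdiff_union_of_subset hSE]
    have heq : I ∪ S = (I ∩ N.E) ∪ S ∪ (I \ N.E) := by grind
    constructor
    · rintro ⟨⟨-, h2⟩, -, hI⟩
      convert h2 using 1
      grind
    · intro h2
      have hI : I ⊆ N.E := hME ▸ subset_union_left.trans h2.subset_ground
      refine ⟨⟨disjoint_sdiff_left.mono_left inter_subset_right, h2.subset ?_⟩,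
        inter_subset_right, hI⟩
      grind

/-- It suffices that `A ∪ S` has rank at least `x(A \ S) + |S|` in `M₂`. A basis extending `S` then
keeps at least `x(A \ S)` elements outside `S`, and the free elements of `A ∩ S` supply `x(A ∩ S)`.
-/
lemma IsVertexRemoval.mem_matroidPolytope (h : IsVertexRemoval x U N N')
    (hx : x ∈ matroidPolytope N) (h1 : ∀ e ∈ U, x e ≤ 1) : x ∈ matroidPolytope N' := by
  obtain ⟨M₂, hME, hSi, hM₂, hE, hN'⟩ := h.exists_union hx
  set S := N.E ∩ U with hS
  refine mem_matroidPolytope_of_exists_indep (hE ▸ hx.1) fun A hA => ?_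
  rw [hE] at hA
  have hASE : A ∪ S ⊆ N.E := union_subset hA inter_subset_left
  obtain ⟨C, hC, -, hCle⟩ := exists_indep_of_mem_matroidPolytope hx N.empty_indep
    (empty_subset (A \ S)) (sdiff_subset.trans hA)
  obtain ⟨B, hB, hCB, hBle⟩ := exists_indep_of_mem_matroidPolytope hx hC.indep
    (hC.subset.trans (sdiff_subset.trans subset_union_left)) hASE
  have hASw : wt x (A ∪ S) = wt x (A \ S) + wt x S := by
    rw [← wt_union disjoint_sdiff_left, Set.sdiff_union_self]
  obtain ⟨J, hJ, hJs, hJle⟩ : ∃ J, M₂.Indep J ∧ J ⊆ A ∪ S ∧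
      wt x (A \ S) + S.ncard ≤ J.ncard := by
    have hfl := Int.floor_le (wt x S)
    -- Either `M₁` can add all of `S \ B`, giving a set that contains `C ∪ S`, or it adds `|S| -
    -- ⌊x(S)⌋` elements to `B`, whose size is at least `x(A ∪ S)`.
    rcases le_or_gt ((S \ B).ncard : ℤ) ((S.ncard : ℤ) - ⌊wt x S⌋) with hk | hk
    · refine ⟨(S \ B) ∪ B, (hM₂ _).2 ⟨_, B, ⟨sdiff_subset, hk⟩, hB.indep, rfl⟩,
        union_subset (sdiff_subset.trans subset_union_right) hB.subset, ?_⟩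
      have hdisj : Disjoint C S := Set.disjoint_left.2 fun e he => (hC.subset he).2
      have h2 : (C ∪ S).ncard ≤ ((S \ B) ∪ B).ncard := Set.ncard_le_ncard (by grind)
      rw [Set.ncard_union_eq hdisj] at h2
      have h3 : (C.ncard : ℝ) + S.ncard ≤ ((S \ B) ∪ B).ncard := by exact_mod_cast h2
      linarith
    · have hk0 : 0 ≤ (S.ncard : ℤ) - ⌊wt x S⌋ := by
        have h2 : wt x S ≤ S.ncard := wt_le_ncard fun e he => h1 e he.2
        have h3 : (⌊wt x S⌋ : ℝ) ≤ S.ncard := hfl.trans h2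
        have h4 : ⌊wt x S⌋ ≤ (S.ncard : ℤ) := by exact_mod_cast h3
        omega
      obtain ⟨k, hkk⟩ := Int.eq_ofNat_of_zero_le hk0
      obtain ⟨I₁, hI₁, hI₁c⟩ := Set.exists_subset_card_eq (s := S \ B) (n := k) (by omega)
      refine ⟨I₁ ∪ B, (hM₂ _).2 ⟨I₁, B, ⟨hI₁.trans sdiff_subset, by omega⟩, hB.indep, rfl⟩,
        union_subset (hI₁.trans (sdiff_subset.trans subset_union_right)) hB.subset, ?_⟩
      rw [Set.ncard_union_eq (disjoint_sdiff_left.mono_left hI₁), hI₁c]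
      have h3 : (S.ncard : ℝ) - ⌊wt x S⌋ = k := by exact_mod_cast hkk
      push_cast
      linarith
  obtain ⟨K, hK, hSK⟩ := hSi.subset_isBasis_of_subset (subset_union_right (s := A))
    (by rwa [hME])
  have hJK := ncard_le_ncard_of_isBasis hJ hJs hK
  have hKc := Set.ncard_sdiff_add_ncard_of_subset hSK
  refine ⟨(K \ S) ∪ (A ∩ S), ?_, (hN' _).2 (hK.indep.subset ?_), ?_⟩
  · rintro e (⟨he, heS⟩ | he)
    exacts [(hK.subset he).resolve_right heS, he.1]
  · grind
  · rw [Set.ncard_union_eq (disjoint_sdiff_left.mono_right inter_subset_right)]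
    have h2 : wt x A = wt x (A \ S) + wt x (A ∩ S) := by
      rw [← wt_union (disjoint_sdiff_left.mono_right inter_subset_right), Set.sdiff_union_inter]
    have h3 : wt x (A ∩ S) ≤ (A ∩ S).ncard := wt_le_ncard fun e he => h1 e he.2.2
    have h4 : (J.ncard : ℝ) ≤ (K \ S).ncard + S.ncard := by
      rw [← hKc] at hJK; exact_mod_cast hJK
    push_cast
    linarith

/-- Drop the elements contributed by `M₁`. There are at most `|S| - ⌊x(S)⌋` of them, and `|S| - x(S)
≤ |U| - x(U) ≤ 4` because `x ≤ 1` on `U`; the floor is harmless since 4 is an integer. -/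
lemma IsVertexRemoval.transform (h : IsVertexRemoval x U N N')
    (hx : x ∈ matroidPolytope N) (h1 : ∀ e ∈ U, x e ≤ 1) (hU : (U.ncard : ℝ) - wt x U ≤ 4)
    {I : Set E} (hI : N'.Indep I) : ∃ R ⊆ I, R.ncard ≤ 4 ∧ N.Indep (I \ R) := by
  obtain ⟨M₂, hME, hSi, hM₂, hE, hN'⟩ := h.exists_union hx
  obtain ⟨I₁, I₂, ⟨-, hc⟩, hI₂, heq⟩ := (hM₂ _).1 ((hN' I).1 hI)
  refine ⟨I ∩ I₁, inter_subset_left, ?_, hI₂.subset fun e he =>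
    ((heq ▸ .inl he.1 : e ∈ I₁ ∪ I₂)).resolve_left fun h => he.2 ⟨he.1, h⟩⟩
  have h2 : (I ∩ I₁).ncard ≤ I₁.ncard := Set.ncard_le_ncard inter_subset_right
  have h3 := wt_diff (x := x) (inter_subset_right (s := N.E) (t := U))
  have h4 : wt x (U \ (N.E ∩ U)) ≤ (U \ (N.E ∩ U)).ncard := wt_le_ncard fun e he => h1 e he.1
  have h5 : ((U \ (N.E ∩ U)).ncard : ℝ) + (N.E ∩ U).ncard = U.ncard := by
    exact_mod_cast Set.ncard_sdiff_add_ncard_of_subset (inter_subset_right (s := N.E) (t := U))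
  have h6 : ((N.E ∩ U).ncard : ℤ) - 4 ≤ ⌊wt x (N.E ∩ U)⌋ := Int.le_floor.2 (by
    push_cast
    linarith)
  omega

/-- In a decomposition of an independent set of the union, `f` can be added to the part that is
independent in `N`. -/
lemma IsVertexRemoval.stays_free (h : IsVertexRemoval x U N N')
    (hx : x ∈ matroidPolytope N) {f : E} (hf : IsFreeElement N f) :
    IsFreeElement N' f := by
  obtain ⟨M₂, hME, hSi, hM₂, hE, hN'⟩ := h.exists_union hx
  refine ⟨hE ▸ hf.1, fun I hI => (hN' _).2 ?_⟩
  obtain ⟨I₁, I₂, hI₁, hI₂, heq⟩ := (hM₂ _).1 ((hN' I).1 hI)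
  exact (hM₂ _).2 ⟨I₁, insert f I₂, hI₁, hf.2 _ hI₂, by rw [Set.insert_union, heq, Set.union_insert]⟩

lemma IsVertexRemoval.isFreeElement (h : IsVertexRemoval x U N N')
    (hx : x ∈ matroidPolytope N) {f : E} (hf : f ∈ U) (hfN : f ∈ N.E) :
    IsFreeElement N' f := by
  obtain ⟨M₂, hME, hSi, hM₂, hE, hN'⟩ := h.exists_union hx
  refine ⟨hE ▸ hfN, fun I hI => (hN' _).2 ?_⟩
  rw [Set.insert_union, Set.insert_eq_of_mem (.inr ⟨hfN, hf⟩)]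
  exact (hN' I).1 hI

lemma IsVertexRemoval.eq_of_disjoint (h : IsVertexRemoval x U N N')
    (hx : x ∈ matroidPolytope N) (hd : Disjoint N.E U) : N' = N := by
  obtain ⟨M₂, hME, hSi, hM₂, hE, hN'⟩ := h.exists_union hx
  have hS : N.E ∩ U = ∅ := Set.disjoint_iff_inter_eq_empty.1 hd
  refine Matroid.ext_indep hE fun I _ => ?_
  rw [hN', hM₂, hS, union_empty]
  constructor
  · rintro ⟨I₁, I₂, ⟨hI₁, -⟩, hI₂, rfl⟩
    rwa [subset_empty_iff.1 hI₁, empty_union]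
  · exact fun hI => ⟨∅, I, ⟨subset_rfl, by simp [wt_empty]⟩, hI, by simp⟩

lemma Removes.vertexwise {w : Set V} {N N' : V → Matroid E} (h : Removes x w U N N')
    (hN : DisjointGrounds N w) (hx : ∀ v ∈ w, x ∈ matroidPolytope (N v))
    (h1 : ∀ e ∈ U, x e ≤ 1) (hU : (U.ncard : ℝ) - wt x U ≤ 4) : VertexwiseRemoval x w U N N' := by
  rcases h with h | h
  · refine ⟨fun v hv => ?_, fun v hv f hf hfv => (h.1 v hv).isFreeElement (hx v hv) hf hfv,
      fun v hv I hI => (h.1 v hv).transform (hx v hv) h1 hU hI,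
      fun v hv => (h.1 v hv).mem_matroidPolytope (hx v hv) h1, fun v hv => ?_,
      fun v hv f hf => (h.1 v hv).stays_free (hx v hv) hf⟩
    · obtain ⟨-, -, -, -, hE, -⟩ := (h.1 v hv).exists_union (hx v hv)
      exact hE
    · by_cases hvw : v ∈ w
      · exact (h.1 v hvw).eq_of_disjoint (hx v hvw) (hv.resolve_left fun h => h hvw)
      · exact h.2 v hvw
  · exact h.vertexwise hN hU

end Removal

/-! ### The current graph as a contraction of `G` -/

section GraphInvariant

variable {V E : Type*} {G : Graph V E} {H : Graph (Set V) E} {C : Set E}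

/-- `H` arises from the loopless graph `G` by deleting edges and contracting the edges in `C`,
which form a forest. -/
structure IsDerivedGraph (G : Graph V E) (H : Graph (Set V) E) (C : Set E) : Prop where
  nonempty : ∀ w ∈ V(H), w.Nonempty
  subset : ∀ w ∈ V(H), w ⊆ V(G)
  eq_of_mem : ∀ w ∈ V(H), ∀ w' ∈ V(H), ∀ v ∈ w, v ∈ w' → w = w'
  cover : ∀ v ∈ V(G), ∃ w ∈ V(H), v ∈ w
  isLink : ∀ f a b, H.IsLink f a b ↔
    f ∈ E(H) ∧ a ∈ V(H) ∧ b ∈ V(H) ∧ ∃ u ∈ a, ∃ v ∈ b, G.IsLink f u v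
  edges : E(H) ⊆ E(G)
  loopless : ∀ f a, ¬ H.IsLink f a a
  contracted_subset : C ⊆ E(G)
  disjoint : Disjoint C E(H)
  connected : ∀ w ∈ V(H), ∀ u ∈ w, ∀ v ∈ w, Relation.ReflTransGen (LinkedBy G C) u v
  card : C.ncard + V(H).ncard = V(G).ncard

lemma isDerivedGraph_initial [G.Loopless] : IsDerivedGraph G (G.map fun v => {v}) ∅ where
  nonempty := by simp
  subset := by simp
  eq_of_mem := by
    rintro _ ⟨a, -, rfl⟩ _ ⟨b, -, rfl⟩ v hv hv'
    rw [← show v = a from hv, ← show v = b from hv']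
  cover v hv := ⟨{v}, ⟨v, hv, rfl⟩, rfl⟩
  isLink f a b := by
    simp only [Graph.map_isLink, Relation.map_apply, Graph.edgeSet_map, Graph.vertexSet_map]
    constructor
    · rintro ⟨u, v, h, rfl, rfl⟩
      exact ⟨h.edge_mem, ⟨u, h.left_mem, rfl⟩, ⟨v, h.right_mem, rfl⟩, u, rfl, v, rfl, h⟩
    · rintro ⟨-, ⟨u, -, rfl⟩, ⟨v, -, rfl⟩, _, rfl, _, rfl, h⟩
      exact ⟨_, _, h, rfl, rfl⟩
  edges := by simp
  loopless f a := by
    rintro ⟨u, v, h, rfl, hv⟩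
    rw [Set.singleton_eq_singleton_iff.1 hv] at h
    exact G.not_isLoopAt f u h
  contracted_subset := empty_subset _
  disjoint := Set.empty_disjoint _
  connected := by
    rintro _ ⟨a, -, rfl⟩ u rfl v rfl
    exact .refl
  card := by
    rw [Set.ncard_empty, zero_add, Graph.vertexSet_map,
      Set.ncard_image_of_injective _ Set.singleton_injective]

namespace IsDerivedGraph

variable (h : IsDerivedGraph G H C)
include h

lemma delete (Z : Set E) : IsDerivedGraph G (H.deleteEdges Z) C where
  nonempty := h.nonempty
  subset := h.subset
  eq_of_mem := h.eq_of_mem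
  cover := h.cover
  isLink f a b := by
    rw [Graph.deleteEdges_isLink, h.isLink, Graph.edgeSet_deleteEdges, Graph.vertexSet_deleteEdges,
      mem_sdiff]
    tauto
  edges := by
    rw [Graph.edgeSet_deleteEdges]
    exact sdiff_subset.trans h.edges
  loopless f a hl := h.loopless f a (Graph.deleteEdges_isLink _ _ _ _ _ ▸ hl).1
  contracted_subset := h.contracted_subset
  disjoint := by
    rw [Graph.edgeSet_deleteEdges]
    exact h.disjoint.mono_right sdiff_subset
  connected := h.connected
  card := h.card

/-- Nodes are nonempty and pairwise disjoint, so a union of nodes determines which nodes form it. -/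
lemma isContractionMap (D : Set E) : IsContractionMap H D (mergedNode H D) := by
  intro a ha b hb
  constructor
  · intro hab
    obtain ⟨v, hv⟩ := h.nonempty a ha
    have hva : v ∈ mergedNode H D a := ⟨a, ⟨ha, .refl _⟩, hv⟩
    rw [hab] at hva
    obtain ⟨w', ⟨hw', hr⟩, hvw⟩ := hva
    rw [h.eq_of_mem a ha w' hw' v hv hvw]
    exact hr.symm
  · intro hab
    ext v
    exact ⟨fun ⟨w', ⟨hw', hr⟩, hv⟩ => ⟨w', ⟨hw', hab.symm.trans _ _ _ hr⟩, hv⟩,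
      fun ⟨w', ⟨hw', hr⟩, hv⟩ => ⟨w', ⟨hw', hab.trans _ _ _ hr⟩, hv⟩⟩

/-- Chains of `EqvGen` may formally pass through sets that are not nodes, so being a node is tracked
along with connectedness. -/
lemma connected_of_eqvGen {D : Set E} {a b : Set V}
    (hab : Relation.EqvGen (LinkedBy H D) a b) :
    (a ∈ V(H) ↔ b ∈ V(H)) ∧ (a ∈ V(H) → ∀ u ∈ a, ∀ v ∈ b,
      Relation.ReflTransGen (LinkedBy G (C ∪ D)) u v) := by
  have hmono : ∀ {u v}, Relation.ReflTransGen (LinkedBy G C) u v →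
      Relation.ReflTransGen (LinkedBy G (C ∪ D)) u v := fun huv =>
    Relation.ReflTransGen.mono (fun _ _ ⟨f, hf, hl⟩ => ⟨f, .inl hf, hl⟩) _ _ huv
  have hsymm : ∀ {u v}, Relation.ReflTransGen (LinkedBy G (C ∪ D)) u v →
      Relation.ReflTransGen (LinkedBy G (C ∪ D)) v u := fun huv => by
    induction huv with
    | refl => exact .refl
    | tail _ hl ih => exact ih.head hl.symm
  induction hab with
  | rel a b hl =>
    obtain ⟨f, hf, hl⟩ := hl
    refine ⟨iff_of_true hl.left_mem hl.right_mem, fun ha u hu v hv => ?_⟩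
    obtain ⟨-, -, -, u', hu', v', hv', hG⟩ := (h.isLink f a b).1 hl
    exact ((hmono (h.connected a ha u hu u' hu')).tail ⟨f, .inr hf, hG⟩).trans
      (hmono (h.connected b hl.right_mem v' hv' v hv))
  | refl a => exact ⟨Iff.rfl, fun ha u hu v hv => hmono (h.connected a ha u hu v hv)⟩
  | symm a b _ ih =>
    exact ⟨ih.1.symm, fun hb u hu v hv => hsymm (ih.2 (ih.1.2 hb) v hv u hu)⟩
  | trans a b c _ _ ih₁ ih₂ =>
    refine ⟨ih₁.1.trans ih₂.1, fun ha u hu v hv => ?_⟩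
    obtain ⟨z, hz⟩ := h.nonempty b (ih₁.1.1 ha)
    exact (ih₁.2 ha u hu z hz).trans (ih₂.2 (ih₁.1.1 ha) z hz v hv)

/-- The tree constraints carry over to the contracted graph. With positive weights they exclude
loops there, and the exact count of merged nodes yields `card`. -/
lemma contract [Finite V] [Fintype E] {x : E → ℝ} (hx : SatisfiesTreeConstraints H x)
    (hpos : ∀ e ∈ E(H), 0 < x e) {D : Set E} (hDE : D ⊆ E(H)) (hD : ∀ e ∈ D, x e = 1) :
    IsDerivedGraph G (contractEdges H D) (C ∪ D) := by
  have hφ := h.isContractionMap D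
  have hself : ∀ a ∈ V(H), a ⊆ mergedNode H D a := fun a ha v hv => ⟨a, ⟨ha, .refl _⟩, hv⟩
  obtain ⟨hx₁, hcard⟩ := hx.contract (Set.toFinite _) hφ hDE hD
  have hVc : V(contractEdges H D) = mergedNode H D '' V(H) := contract_vertexSet
  have hEc : E(contractEdges H D) = E(H) \ D := contract_edgeSet
  have heq : ∀ w ∈ V(contractEdges H D), ∀ w' ∈ V(contractEdges H D), ∀ v ∈ w, v ∈ w' →
      w = w' := by
    rw [hVc]
    rintro _ ⟨a, ha, rfl⟩ _ ⟨b, hb, rfl⟩ v ⟨w, ⟨hw, hr⟩, hv⟩ ⟨w', ⟨hw', hr'⟩, hv'⟩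
    rw [← h.eq_of_mem w hw w' hw' v hv hv'] at hr'
    exact (hφ a ha b hb).2 (hr.trans _ _ _ hr'.symm)
  refine ⟨?_, ?_, heq, ?_, ?_, ?_, ?_, ?_, ?_, ?_, ?_⟩
  · rw [hVc]
    rintro _ ⟨a, ha, rfl⟩
    exact (h.nonempty a ha).mono (hself a ha)
  · rw [hVc]
    rintro _ ⟨a, ha, rfl⟩ v ⟨w, ⟨hw, -⟩, hv⟩
    exact h.subset w hw hv
  · intro v hv
    obtain ⟨w, hw, hvw⟩ := h.cover v hv
    exact ⟨_, hVc ▸ ⟨w, hw, rfl⟩, hself w hw hvw⟩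
  · intro f c d
    constructor
    · intro hl
      obtain ⟨-, a, b, hab, rfl, rfl⟩ := contract_isLink.1 hl
      obtain ⟨-, -, -, u, hu, v, hv, hG⟩ := (h.isLink f a b).1 hab
      exact ⟨hl.edge_mem, hl.left_mem, hl.right_mem, u, hself a hab.left_mem hu, v,
        hself b hab.right_mem hv, hG⟩
    · rintro ⟨hf, hc, hd, u, hu, v, hv, hG⟩
      rw [hEc] at hf
      have key : ∀ a b, H.IsLink f a b → u ∈ a → v ∈ b →
          (contractEdges H D).IsLink f c d := by
        intro a b hab hua hvb
        refine contract_isLink.2 ⟨hf.2, a, b, hab, ?_, ?_⟩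
        · exact heq _ (hVc ▸ ⟨a, hab.left_mem, rfl⟩) _ hc u (hself a hab.left_mem hua) hu
        · exact heq _ (hVc ▸ ⟨b, hab.right_mem, rfl⟩) _ hd v (hself b hab.right_mem hvb) hv
      obtain ⟨a, b, hab⟩ := Graph.exists_isLink_of_mem_edgeSet hf.1
      obtain ⟨-, -, -, u', hu', v', hv', hG'⟩ := (h.isLink f a b).1 hab
      obtain ⟨rfl, rfl⟩ | ⟨rfl, rfl⟩ := hG.eq_and_eq_or_eq_and_eq hG'
      · exact key a b hab hu' hv'
      · exact key b a hab.symm hv' hu'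
  · rw [hEc]
    exact sdiff_subset.trans h.edges
  · refine hx₁.not_isLink_self fun e he => hpos e ?_
    rw [contract_edgeSet] at he
    exact he.1
  · exact union_subset h.contracted_subset (hDE.trans h.edges)
  · rw [hEc, disjoint_union_left]
    exact ⟨h.disjoint.mono_right sdiff_subset, disjoint_sdiff_right⟩
  · rw [hVc]
    rintro _ ⟨a, ha, rfl⟩ u ⟨w, ⟨hw, hr⟩, hu⟩ v ⟨w', ⟨hw', hr'⟩, hv⟩
    exact (h.connected_of_eqvGen (hr.symm.trans _ _ _ hr')).2 hw u hu v hv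
  · rw [Set.ncard_union_eq (h.disjoint.mono_right hDE), ← h.card, hcard]
    change _ + V((H.deleteEdges D).map _).ncard = _
    omega

/-- An edge of `H` joins the nodes containing its end vertices in `G`. -/
lemma isLink_of_isLink {f : E} (hf : f ∈ E(H)) {u v : V} (hG : G.IsLink f u v) {w : Set V}
    (hw : w ∈ V(H)) (hu : u ∈ w) : ∃ w', v ∈ w' ∧ H.IsLink f w w' := by
  obtain ⟨w', hw', hv⟩ := h.cover v hG.right_mem
  exact ⟨w', hv, (h.isLink f w w').2 ⟨hf, hw, hw', u, hu, v, hv, hG⟩⟩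

/-- An edge in the ground sets of two vertices of one node would be a loop of `H`. -/
lemma disjointGrounds {N : V → Matroid E}
    (hN : ∀ v ∈ V(G), (N v).E = E(H) ∩ G.incidenceSet v) {w : Set V} (hw : w ∈ V(H)) :
    DisjointGrounds N w := by
  rintro ⟨u, hu⟩ ⟨v, hv⟩ huv
  simp only [Function.onFun]
  rw [hN u (h.subset w hw hu), hN v (h.subset w hw hv), Set.disjoint_left]
  rintro f ⟨hf, z, hz⟩ ⟨-, hfv⟩
  rcases Graph.Inc.eq_or_eq_of_isLink hfv hz with rfl | rfl
  · exact huv rfl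
  · exact h.loopless f w ((h.isLink f w w).2 ⟨hf, hw, hw, u, hu, v, hv, hz⟩)

lemma mem_containedEdges_iff {N : V → Matroid E}
    (hN : ∀ v ∈ V(G), (N v).E = E(H) ∩ G.incidenceSet v) {w : Set V} (hw : w ∈ V(H)) {v : V}
    (hv : v ∈ w) {f : E} (hf : f ∈ (N v).E) :
    f ∈ containedEdges H N w ↔ ¬ IsFreeElement (N v) f := by
  have hf' := hf
  rw [hN v (h.subset w hw hv)] at hf'
  obtain ⟨hfE, z, hz⟩ := hf'
  obtain ⟨w', -, hl⟩ := h.isLink_of_isLink hfE hz hw hv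
  rw [containedEdges, mem_ofPred_eq,
    isFreeElement_nodeConstraint_iff (h.disjointGrounds hN hw) hv hf]
  exact and_iff_right hl.inc_left

end IsDerivedGraph

end GraphInvariant

/-! ### Accounting of violations at each vertex -/

section Budget

variable {V E : Type*} {G : Graph V E} {H : Graph (Set V) E} {M N N' : V → Matroid E}
  {C K : Set E}

/-- Every independent set of `N` together with the edges of `C` in `δ` becomes independent in `M`
after removing at most `k` edges. -/
def IsWithinBudget (M N : Matroid E) (δ C : Set E) (k : ℕ) : Prop :=
  ∀ I, N.Indep I → ∃ R ⊆ I ∪ C ∩ δ, R.ncard ≤ k ∧ M.Indep ((I ∪ C ∩ δ) \ R)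

lemma IsWithinBudget.transform [Finite E] {M N N' : Matroid E} {δ C : Set E} {k l : ℕ}
    (h : IsWithinBudget M N δ C k)
    (hN : ∀ I, N'.Indep I → ∃ R ⊆ I, R.ncard ≤ l ∧ N.Indep (I \ R)) :
    IsWithinBudget M N' δ C (l + k) := by
  intro I hI
  obtain ⟨R, hR, hRc, hRi⟩ := hN I hI
  obtain ⟨R', hR', hRc', hRi'⟩ := h _ hRi
  refine ⟨R ∪ R', union_subset (hR.trans subset_union_left)
    (hR'.trans (union_subset_union_left _ sdiff_subset)),
    (Set.ncard_union_le _ _).trans (add_le_add hRc hRc'), hRi'.subset ?_⟩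
  rintro e ⟨he, heR⟩
  rw [mem_union, not_or] at heR
  exact ⟨he.imp (fun h => ⟨h, heR.1⟩) id, heR.2⟩

/-- The edges of `G` at `v` have undergone adaptations of type A and B costing at most `a` and `b`,
and no further adaptation of a type that already had a cost is possible. -/
structure VertexBudget (G : Graph V E) (M N : V → Matroid E) (C K : Set E) (v : V) (a b : ℕ) :
    Prop where
  le_a : a ≤ 4
  le_b : b ≤ 4
  type_a : 0 < a → ∀ f ∈ (N v).E, ¬ IsFreeElement (N v) f → ∀ u, G.IsLink f v u →
    IsFreeElement (N u) f
  type_b : 0 < b → ∀ f ∈ (N v).E, ¬ IsFreeElement (N v) f → f ∈ K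
  within : IsWithinBudget (M v) (N v) (G.incidenceSet v) C (a + b)

/-- The invariant of the degree constraints; `K` is the set of edges incident to a node that has
been chosen for the set `Q`. -/
structure ConstraintInvariant (G : Graph V E) (H : Graph (Set V) E) (M : V → Matroid E)
    (C K : Set E) (N : V → Matroid E) : Prop where
  ground : ∀ v ∈ V(G), (N v).E = E(H) ∩ G.incidenceSet v
  budget : ∀ v ∈ V(G), ∃ a b, VertexBudget G M N C K v a b

lemma constraintInvariant_initial (hM : ∀ v ∈ V(G), (M v).E = G.incidenceSet v) :
    ConstraintInvariant G (G.map fun v => ({v} : Set V)) M ∅ K M where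
  ground v hv := by
    rw [hM v hv, Graph.edgeSet_map, inter_eq_right.2 (G.incidenceSet_subset_edgeSet v)]
  budget v _ := ⟨0, 0, by simp, by simp, by simp, by simp,
    fun I hI => ⟨∅, by simp, by simp, by simpa using hI⟩⟩

/-- Free elements stay free, so fewer edges need checking; `K'` only has to retain the surviving
edges of `K`. -/
lemma ConstraintInvariant.delete {K' : Set E} (h : ConstraintInvariant G H M C K N) (Z : Set E)
    (hK : ∀ f ∈ E(H), f ∉ Z → f ∈ K → f ∈ K') :
    ConstraintInvariant G (H.deleteEdges Z) M C K' (fun v => (N v).delete Z) where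
  ground v hv := by
    rw [Matroid.delete_ground, h.ground v hv, Graph.edgeSet_deleteEdges]
    grind
  budget v hv := by
    obtain ⟨a, b, hab⟩ := h.budget v hv
    refine ⟨a, b, hab.le_a, hab.le_b, fun ha f hf hfree u hu => ?_, fun hb f hf hfree => ?_,
      fun I hI => hab.within I (Matroid.delete_indep_iff.1 hI).1⟩
    · exact (hab.type_a ha f hf.1 (fun h => hfree (h.delete hf.2)) u hu).delete hf.2
    · have hfE := hf.1
      rw [h.ground v hv] at hfE
      exact hK f hfE.1 hf.2 (hab.type_b hb f hf.1 fun h => hfree (h.delete hf.2))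

/-- An independent set of the contraction together with `D` was independent before, so `D` moves
from the independent part to the contracted part at no cost. -/
lemma ConstraintInvariant.contract {K' D : Set E} (h : ConstraintInvariant G H M C K N)
    (hD : ∀ v ∈ V(G), (N v).Indep (D ∩ (N v).E)) (hDE : D ⊆ E(H))
    (hK : ∀ f ∈ E(H), f ∉ D → f ∈ K → f ∈ K') :
    ConstraintInvariant G (contractEdges H D) M (C ∪ D) K' (fun v => (N v).contract D) where
  ground v hv := by
    rw [Matroid.contract_ground, h.ground v hv, contractEdges, contract_edgeSet]
    grind
  budget v hv := by
    obtain ⟨a, b, hab⟩ := h.budget v hv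
    refine ⟨a, b, hab.le_a, hab.le_b, fun ha f hf hfree u hu => ?_, fun hb f hf hfree => ?_,
      fun I hI => ?_⟩
    · exact (hab.type_a ha f hf.1 (fun h => hfree (h.contract (hD v hv) hf.2)) u hu).contract
        (hD u hu.right_mem) hf.2
    · have hfE : f ∈ (N v).E := hf.1
      rw [h.ground v hv] at hfE
      exact hK f hfE.1 hf.2 (hab.type_b hb f hf.1 fun h => hfree (h.contract (hD v hv) hf.2))
    · have hI' := ((contract_indep_iff_of_indep (hD v hv)).1 hI).2
      have heq : I ∪ (C ∪ D) ∩ G.incidenceSet v =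
          (I ∪ D ∩ (N v).E) ∪ C ∩ G.incidenceSet v := by
        rw [h.ground v hv]
        grind
      rw [heq]
      exact hab.within _ hI'

end Budget

/-! ### Effect of the adaptations on the budgets -/

section Adaptation

variable {V E : Type*} [Fintype E] {G : Graph V E} {H : Graph (Set V) E}
  {M N N' : V → Matroid E} {C K U : Set E} {x : E → ℝ} {w : Set V}

lemma VertexwiseRemoval.isFreeElement_mono (hr : VertexwiseRemoval x w U N N') {v : V} {f : E}
    (hf : IsFreeElement (N v) f) : IsFreeElement (N' v) f := by
  by_cases hv : v ∈ w
  · exact hr.stays_free v hv f hf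
  · rwa [hr.unchanged v (.inl hv)]

lemma VertexwiseRemoval.ground_eq (hr : VertexwiseRemoval x w U N N') (v : V) :
    (N' v).E = (N v).E := by
  by_cases hv : v ∈ w
  · exact hr.ground v hv
  · rw [hr.unchanged v (.inl hv)]

lemma VertexBudget.of_eq (hr : VertexwiseRemoval x w U N N') {v : V} (hv : N' v = N v) {a b : ℕ}
    (h : VertexBudget G M N C K v a b) : VertexBudget G M N' C K v a b where
  le_a := h.le_a
  le_b := h.le_b
  type_a := by
    rw [hv]
    exact fun ha f hf hfree u hu => hr.isFreeElement_mono (h.type_a ha f hf hfree u hu)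
  type_b := by rw [hv]; exact h.type_b
  within := by rw [hv]; exact h.within

lemma ConstraintInvariant.typeA (hH : IsDerivedGraph G H C) (h : ConstraintInvariant G H M C K N)
    (hw : w ∈ V(H)) (hr : VertexwiseRemoval x w (typeASet H N w) N N') :
    ConstraintInvariant G H M C K N' where
  ground v hv := by rw [hr.ground_eq, h.ground v hv]
  budget v hv := by
    obtain ⟨a, b, hab⟩ := h.budget v hv
    by_cases hun : v ∉ w ∨ Disjoint (N v).E (typeASet H N w)
    · exact ⟨a, b, hab.of_eq hr (hr.unchanged v hun)⟩
    rw [not_or, not_not, Set.not_disjoint_iff] at hun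
    obtain ⟨hvw, f₀, hf₀, hf₀U⟩ := hun
    have hmem : ∀ f ∈ (N v).E, ∀ u, G.IsLink f v u → ∃ w', H.IsLink f w w' ∧
        (f ∈ containedEdges H N w' ↔ ¬ IsFreeElement (N u) f) := by
      intro f hf u hu
      rw [h.ground v hv] at hf
      obtain ⟨w', huw', hl⟩ := hH.isLink_of_isLink hf.1 hu hw hvw
      refine ⟨w', hl, hH.mem_containedEdges_iff h.ground hl.right_mem huw' ?_⟩
      rw [h.ground u hu.right_mem]
      exact ⟨hf.1, hu.inc_right⟩
    -- A second type A payment is impossible: `f₀` is contained at both ends, whereas after a first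
    -- payment its other end would be free.
    have ha : a = 0 := by
      by_contra ha
      have hf₀' := hf₀
      rw [h.ground v hv] at hf₀'
      obtain ⟨u, hu⟩ : G.Inc f₀ v := hf₀'.2
      obtain ⟨w', hl, hiff⟩ := hmem f₀ hf₀ u hu
      refine hiff.1 (hf₀U.2 w' hl.inc_right) (hab.type_a (Nat.pos_of_ne_zero ha) f₀ hf₀ ?_ u hu)
      exact (hH.mem_containedEdges_iff h.ground hw hvw hf₀).1 (hf₀U.2 w hf₀U.1)
    subst ha
    refine ⟨4, b, le_rfl, hab.le_b, fun _ f hf hfree u hu => ?_, fun hb f hf hfree => ?_, ?_⟩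
    · rw [hr.ground_eq] at hf
      -- An edge not free at either end now was not free at either end before, so it belonged to the
      -- removed set and is free at `v`.
      by_contra hcon
      obtain ⟨w', hl, hiff⟩ := hmem f hf u hu
      refine hfree (hr.free v hvw f ⟨hl.inc_left, fun z hz => ?_⟩ hf)
      rcases hz.eq_or_eq_of_isLink hl with rfl | rfl
      · exact (hH.mem_containedEdges_iff h.ground hw hvw hf).2
          fun h => hfree (hr.isFreeElement_mono h)
      · exact hiff.2 fun h => hcon (hr.isFreeElement_mono h)
    · rw [hr.ground_eq] at hf
      exact hab.type_b hb f hf fun h => hfree (hr.isFreeElement_mono h)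
    · simpa using hab.within.transform (hr.transform v hvw)

lemma ConstraintInvariant.typeB {Q : Set (Set V)} (hH : IsDerivedGraph G H C)
    (h : ConstraintInvariant G H M C {f | ∃ q ∈ Q, H.Inc f q} N)
    (hw : w ∈ V(H)) (hr : VertexwiseRemoval x w (typeBSet H Q N w) N N') :
    ConstraintInvariant G H M C {f | ∃ q ∈ Q, H.Inc f q} N' where
  ground v hv := by rw [hr.ground_eq, h.ground v hv]
  budget v hv := by
    obtain ⟨a, b, hab⟩ := h.budget v hv
    by_cases hun : v ∉ w ∨ Disjoint (N v).E (typeBSet H Q N w)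
    · exact ⟨a, b, hab.of_eq hr (hr.unchanged v hun)⟩
    rw [not_or, not_not, Set.not_disjoint_iff] at hun
    obtain ⟨hvw, f₀, hf₀, hf₀U⟩ := hun
    -- After a first type B payment `f₀` would be incident to `Q`, but the removed set avoids `Q`.
    have hb : b = 0 := by
      by_contra hb
      obtain ⟨q, hq, hi⟩ := hab.type_b (Nat.pos_of_ne_zero hb) f₀ hf₀
        ((hH.mem_containedEdges_iff h.ground hw hvw hf₀).1 hf₀U.1)
      exact hf₀U.2 q hq hi
    subst hb
    refine ⟨a, 4, hab.le_a, le_rfl, fun ha f hf hfree u hu => ?_, fun _ f hf hfree => ?_, ?_⟩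
    · rw [hr.ground_eq] at hf
      exact hr.isFreeElement_mono
        (hab.type_a ha f hf (fun h => hfree (hr.isFreeElement_mono h)) u hu)
    · rw [hr.ground_eq] at hf
      by_contra hcon
      refine hfree (hr.free v hvw f ⟨?_, fun q hq hi => hcon ⟨q, hq, hi⟩⟩ hf)
      exact (hH.mem_containedEdges_iff h.ground hw hvw hf).2
        fun h => hfree (hr.isFreeElement_mono h)
    · simpa [add_comm] using hab.within.transform (hr.transform v hvw)

lemma AdaptLoop.preserves {U : (V → Matroid E) → Set V → Set E} {ws : List (Set V)}
    {P : (V → Matroid E) → Prop}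
    (hP : ∀ w ∈ ws, ∀ N N', P N → IsEligible x (U N w) → Removes x w (U N w) N N' → P N')
    (h : AdaptLoop x U ws N N') (hN : P N) : P N' := by
  induction h with
  | done N => exact hN
  | skip w ws N N' _ _ ih => exact ih (fun w hw => hP w (List.mem_cons_of_mem _ hw)) hN
  | adapt w ws N N₁ N' he hr _ ih =>
    exact ih (fun w hw => hP w (List.mem_cons_of_mem _ hw))
      (hP w List.mem_cons_self N N₁ hN he hr)

/-- Feasibility of `x` is carried along because the analysis of the next explicit removal needs it.
-/
lemma AdaptAll.preserves {U : (V → Matroid E) → Set V → Set E} (hH : IsDerivedGraph G H C)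
    (hx : SatisfiesTreeConstraints H x) (hU : ∀ N, ∀ w, U N w ⊆ E(H))
    (hstep : ∀ w ∈ V(H), ∀ N N', ConstraintInvariant G H M C K N →
      VertexwiseRemoval x w (U N w) N N' → ConstraintInvariant G H M C K N')
    (h : AdaptAll H x U N N') (hN : ConstraintInvariant G H M C K N)
    (hNx : ∀ v ∈ V(G), x ∈ matroidPolytope (N v)) :
    ConstraintInvariant G H M C K N' ∧ ∀ v ∈ V(G), x ∈ matroidPolytope (N' v) := by
  obtain ⟨ws, -, hws, hloop⟩ := h
  refine hloop.preserves (P := fun N => ConstraintInvariant G H M C K N ∧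
    ∀ v ∈ V(G), x ∈ matroidPolytope (N v)) ?_ ⟨hN, hNx⟩
  rintro w hw N N' ⟨hN, hNx⟩ he hr
  rw [hws] at hw
  have hr' := hr.vertexwise (hH.disjointGrounds hN.ground hw)
    (fun v hv => hNx v (hH.subset w hw hv)) (fun e he => hx.le_one (hU N w he)) he.2
  refine ⟨hstep w hw N N' hN hr', fun v hv => ?_⟩
  by_cases hvw : v ∈ w
  · exact hr'.feasible v hvw
  · rw [hr'.unchanged v (.inl hvw)]; exact hNx v hv

end Adaptation

/-! ### The invariant over the iterations -/

section Iterations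

variable {V E : Type*} [Fintype E] {G : Graph V E} {M : V → Matroid E}

/-- The fixed equations determine the weight of every tight constraint. -/
lemma IsMaximalTightFamily.wt_eq {α : Type*} {H : Graph α E} {x y : E → ℝ} {𝓛 : Set (Set α)}
    (h𝓛 : IsMaximalTightFamily H x 𝓛)
    (hy : ∀ L ∈ 𝓛, wt y (edgesWithin H L) = wt x (edgesWithin H L)) {L : Set α}
    (hL : IsTight H x L) : wt y (edgesWithin H L) = wt x (edgesWithin H L) := by
  classical
  set φ : Set α → E → ℝ := fun L => (edgesWithin H L).indicator (1 : E → ℝ) with hφ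
  -- Otherwise the constraint of `L` could be added to the maximal family.
  have hspan : φ L ∈ Submodule.span ℝ (φ '' 𝓛) := by
    by_contra hcon
    have hmem := h𝓛.2 (y := insert L 𝓛)
      ⟨by
        rintro L' (rfl | hL')
        exacts [hL, h𝓛.1.1 L' hL'], h𝓛.1.2.insert hcon⟩ (subset_insert _ _) (mem_insert _ _)
    exact hcon (Submodule.subset_span ⟨L, hmem, rfl⟩)
  have hwt : ∀ z : E → ℝ, ∀ L, wt z (edgesWithin H L) = Fintype.linearCombination ℝ z (φ L) := by
    intro z L
    rw [wt_eq_sum_mul, Fintype.linearCombination_apply]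
    rfl
  rw [hwt, hwt]
  refine LinearMap.eqOn_span (s := φ '' 𝓛) ?_ hspan
  rintro _ ⟨L', hL', rfl⟩
  rw [← hwt, ← hwt, hy L' hL']

/-- The invariant of the states of the algorithm. -/
structure StateInvariant (G : Graph V E) (M : V → Matroid E) (s : State V E) : Prop where
  graph : IsDerivedGraph G s.H s.contracted
  constraints : ∃ Q, (∀ y ∈ lpFeasible s, QReachable s.H y Q) ∧
    ConstraintInvariant G s.H M s.contracted {f | ∃ q ∈ Q, s.H.Inc f q} s.N

lemma stateInvariant_initial [G.Loopless] (hM : ∀ v ∈ V(G), (M v).E = G.incidenceSet v) :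
    StateInvariant G M (initialState G M) :=
  ⟨isDerivedGraph_initial, ∅, fun _ _ => .empty, constraintInvariant_initial hM⟩

/-- The invariant requires `Q` to be reachable for all feasible points because the next solution is
not known yet. Specialized to the current `x`, it is passed through deletion and contraction and
compared with the new `Q`. -/
lemma StateInvariant.iteration [Finite V] (hG : V(G).Nonempty) {c : E → ℝ} {s t : State V E}
    (hs : StateInvariant G M s) (h : Iteration c s t) : StateInvariant G M t := by
  classical
  obtain ⟨-, x, s₁, 𝓛, Q, NA, NB, ⟨hxe, -⟩, rfl, h𝓛, hQ, hA, hB, rfl⟩ := h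
  obtain ⟨hgraph, Q₀, hQ₀, hcon⟩ := hs
  have hxF : x ∈ lpFeasible s := hxe.1
  have hQ₀ := hQ₀ x hxF
  obtain ⟨hxT, hxN, -⟩ := hxF
  have hxN' : ∀ v ∈ V(G), x ∈ matroidPolytope (s.N v) := by
    intro v hv
    obtain ⟨w, hw, hvw⟩ := hgraph.cover v hv
    exact mem_matroidPolytope_of_nodeConstraint (hgraph.disjointGrounds hcon.ground hw)
      (hxN w hw) hvw
  have hx := SatisfiesTreeConstraints.of_mem hxT
  set Z : Set E := {f | f ∈ E(s.H) ∧ x f = 0} with hZ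
  have hZ0 : ∀ e ∈ Z, x e = 0 := fun e he => he.2
  set H₀ := s.H.deleteEdges Z with hH₀
  have hgraph₀ : IsDerivedGraph G H₀ s.contracted := hgraph.delete Z
  have hx₀ : SatisfiesTreeConstraints H₀ x := hx.delete hZ0
  have hpos : ∀ e ∈ E(H₀), 0 < x e := by
    intro e he
    rw [hH₀, Graph.edgeSet_deleteEdges] at he
    exact lt_of_le_of_ne (hxT.1 e) fun h => he.2 ⟨he.1, h.symm⟩
  set D : Set E := {f | f ∈ E(H₀) ∧ x f = 1} with hD
  have hD1 : ∀ e ∈ D, x e = 1 := fun e he => he.2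
  have hDE : D ⊆ E(H₀) := fun e he => he.1
  have hφ := hgraph₀.isContractionMap D
  have hgraph₁ : IsDerivedGraph G (contractEdges H₀ D) (s.contracted ∪ D) :=
    hgraph₀.contract hx₀ hpos hDE hD1
  have hx₁ : SatisfiesTreeConstraints (contractEdges H₀ D) x :=
    (hx₀.contract (Set.toFinite _) hφ hDE hD1).1
  obtain ⟨Q₁, hQ₁, hcov, -⟩ := (hQ₀.delete hZ0).contract hφ hpos (D := D) fun e => Iff.rfl
  change IsMaximalTightFamily (contractEdges H₀ D) x 𝓛 at h𝓛
  change IsQ (contractEdges H₀ D) x Q at hQ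
  change AdaptAll (contractEdges H₀ D) x (typeASet (contractEdges H₀ D))
    (fun v => ((s.N v).delete Z).contract D) NA at hA
  change AdaptAll (contractEdges H₀ D) x (typeBSet (contractEdges H₀ D) Q) NA NB at hB
  have hne : V(contractEdges H₀ D).Nonempty := by
    obtain ⟨v, hv⟩ := hG
    obtain ⟨w, hw, -⟩ := hgraph₁.cover v hv
    exact ⟨w, hw⟩
  have hQcov : ∀ f, f ∉ D → (∃ q ∈ Q₀, H₀.Inc f q) → ∃ q ∈ Q, (contractEdges H₀ D).Inc f q :=
    fun f hf hq =>
      hQ.exists_inc hQ₁ (Set.toFinite _) hne hx₁ hgraph₁.loopless (hcov f hf hq)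
  have hNx₀ : ∀ v ∈ V(G), x ∈ matroidPolytope ((s.N v).delete Z) :=
    fun v hv => mem_matroidPolytope_delete (hxN' v hv) Z
  have hcon₀ : ConstraintInvariant G H₀ M s.contracted {f | ∃ q ∈ Q₀, H₀.Inc f q}
      (fun v => (s.N v).delete Z) := by
    refine hcon.delete Z ?_
    rintro f - hfZ ⟨q, hq, hi⟩
    exact ⟨q, hq, Graph.deleteEdges_inc.2 ⟨hi, hfZ⟩⟩
  have hcon₁ : ConstraintInvariant G (contractEdges H₀ D) M (s.contracted ∪ D)
      {f | ∃ q ∈ Q, (contractEdges H₀ D).Inc f q} (fun v => ((s.N v).delete Z).contract D) :=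
    hcon₀.contract
      (fun v hv => indep_of_mem_matroidPolytope (hNx₀ v hv) inter_subset_right
        fun e he => hD1 e he.1) hDE fun f _ hf hq => hQcov f hf hq
  obtain ⟨hconA, hNxA⟩ := hA.preserves hgraph₁ hx₁
    (fun N w f hf => Graph.Inc.edge_mem hf.1)
    (fun w hw N N' hN hr => hN.typeA hgraph₁ hw hr) hcon₁
    (fun v hv => mem_matroidPolytope_contract (hNx₀ v hv) hD1)
  obtain ⟨hconB, -⟩ := hB.preserves hgraph₁ hx₁
    (fun N w f hf => Graph.Inc.edge_mem hf.1.1)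
    (fun w hw N N' hN hr => hN.typeB hgraph₁ hw hr) hconA hNxA
  refine ⟨hgraph₁, Q, fun y hy => ?_, hconB⟩
  refine hQ.1.of_eq_on_tight (Set.toFinite _) hne hx₁.total hgraph₁.loopless fun L hL => ?_
  refine h𝓛.wt_eq (fun L' hL' => ?_) hL
  have h1 := hy.2.2 (edgesWithin (contractEdges H₀ D) L', (L'.ncard : ℤ) - 1)
    (.inr ⟨L', hL', rfl⟩)
  -- At the moment of fixing, the equations involve only uncontracted edges, so the correction term
  -- vanishes.
  have h2 : edgesWithin (contractEdges H₀ D) L' ∩ (s.contracted ∪ D) = ∅ := by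
    rw [← Set.disjoint_iff_inter_eq_empty]
    exact (hgraph₁.disjoint.mono_right edgesWithin_subset).symm
  change wt y (edgesWithin (contractEdges H₀ D) L') +
    ((edgesWithin (contractEdges H₀ D) L' ∩ (s.contracted ∪ D)).ncard : ℝ) =
      (((L'.ncard : ℤ) - 1 : ℤ) : ℝ) at h1
  rw [h2, Set.ncard_empty] at h1
  rw [(h𝓛.1.1 L' hL').2.2]
  push_cast at h1
  linarith

lemma StateInvariant.isSpanningTree_and_violatesByAtMost [Finite V] (hG : V(G).Nonempty)
    {s : State V E} (hs : StateInvariant G M s) (hcard : ¬ 1 < V(s.H).ncard) :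
    IsSpanningTree G s.contracted ∧
      ∀ v ∈ V(G), ViolatesByAtMost (M v) (G.incidenceSet v) s.contracted 8 := by
  obtain ⟨hgraph, Q, -, hcon⟩ := hs
  obtain ⟨v₀, hv₀⟩ := hG
  obtain ⟨w, hw, hv₀w⟩ := hgraph.cover v₀ hv₀
  have hsub : V(s.H) ⊆ {w} := by
    intro w' hw'
    exact (Set.ncard_le_one (Set.toFinite _)).1 (not_lt.1 hcard) w' hw' w hw
  have heq : V(s.H) = {w} := subset_antisymm hsub (by simpa using hw)
  have hall : ∀ v ∈ V(G), v ∈ w := by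
    intro v hv
    obtain ⟨w', hw', hvw'⟩ := hgraph.cover v hv
    rwa [← show w' = w from hsub hw']
  refine ⟨⟨hgraph.contracted_subset, ?_, fun u hu v hv =>
    hgraph.connected w hw u (hall u hu) v (hall v hv)⟩, fun v hv => ?_⟩
  · rw [← hgraph.card, heq, Set.ncard_singleton]
  · obtain ⟨a, b, hab⟩ := hcon.budget v hv
    -- For the empty independent set, the budget speaks of the contracted edges at `v` alone, and `a
    -- + b ≤ 8`.
    obtain ⟨R, hR, hRc, hRi⟩ := hab.within ∅ (Matroid.empty_indep _)
    rw [empty_union] at hR hRi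
    have h1 := hab.le_a
    have h2 := hab.le_b
    refine ⟨R, by rwa [inter_comm], by omega, ?_⟩
    convert hRi using 1
    grind

end Iterations

end MatroidalMST

theorem mainTheorem8 {V E : Type*} [Finite V] [Fintype E]
    (G : Graph V E) [G.Loopless] (hG : V(G).Nonempty)
    (M : V → Matroid E) (hM : ∀ v ∈ V(G), (M v).E = G.incidenceSet v)
    (c : E → ℝ) (hc : ∀ e, 0 ≤ c e)
    (T : Set E) (hT : MatroidalMST.TerminatesWith G M c T) :
    MatroidalMST.IsSpanningTree G T ∧
      ∀ v ∈ V(G), MatroidalMST.ViolatesByAtMost (M v) (G.incidenceSet v) T 8 := by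
  obtain ⟨s, hreach, hcard, rfl⟩ := hT
  have hs : MatroidalMST.StateInvariant G M s := by
    clear hcard
    induction hreach with
    | refl => exact MatroidalMST.stateInvariant_initial hM
    | tail _ hst ih => exact ih.iteration hG hst
  exact hs.isSpanningTree_and_violatesByAtMost hG hcard
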